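/- Let $H_3(\mathbb R)$ be the Heisenberg group of real matrices $[x,y,z]=\begin{pmatrix}1&x&z\\0&1&y\\0&0&1\end{pmatrix}$, so that $[x,y,z]\,[x',y',z']=[x+x',\,y+y',\,z+z'+xy']$, and let $H_3(\mathbb Z)$ be the subgroup of its integer matrices. Let $M=\begin{pmatrix}A&B\\C&D\end{pmatrix}$ be a matrix with integer entries and $|\det M|=1$, and let $\lambda\in\mathbb C$ be an eigenvalue of $M$ with $|\lambda|>1$. Then $\lambda$ is real, $\lambda\ne\det M$, and $M$ has exactly one eigenvector $(\alpha,\beta)$ for $\lambda$ with $\alpha+\beta=1$; it is real. For integers $n,m$ put $$\gamma=\frac{\alpha}{\lambda-\det M}\Bigl(n-\frac{AC}{2}\Bigr)+\frac{\beta}{\lambda-\det M}\Bigl(m-\frac{BD}{2}\Bigr).$$ Let $Y=\{[x,-x+k,z] : x,z\in\mathbb R,\ k\in\mathbb Z\}/H_3(\mathbb Z)$, a subspace of the space of left cosets $gH_3(\mathbb Z)$ of $H_3(\mathbb R)$. Then $Y$ is homeomorphic to the torus $(\mathbb R/\mathbb Z)^2$, and for all $n,m$ the niltranslation $$T:Y\to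 Y,\qquad T\bigl(gH_3(\mathbb Z)\bigr)=\bigl[\alpha,\ \beta,\ \gamma+\tfrac{\alpha\beta}{2}\bigr]\,g\,H_3(\mathbb Z),$$ is minimal (every forward orbit is dense), uniquely ergodic (it has exactly one invariant Borel probability measure $\mu$), and self-induced: there is a Borel set $E\subset Y$ with $0<\mu(E)<1$, each point of which returns to $E$ under $T$, and a bimeasurable bijection $E\to Y$ that conjugates the first return map of $T$ on $E$ to $T$ and carries $\mu|_E/\mu(E)$ to $\mu$. -/

import Mathlib

open MeasureTheory

/-- The real Heisenberg group: `[x, y, z]` is the upper triangular matrix with rows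
`(1, x, z)`, `(0, 1, y)`, `(0, 0, 1)`. -/
@[ext]
structure Heisenberg where
  x : ℝ
  y : ℝ
  z : ℝ

namespace Heisenberg

/-- Matrix multiplication in the coordinates `[x, y, z]`. -/
instance : Mul Heisenberg := ⟨fun g h => ⟨g.x + h.x, g.y + h.y, g.z + h.z + g.x * h.y⟩⟩

instance : One Heisenberg := ⟨⟨0, 0, 0⟩⟩

instance : Inv Heisenberg := ⟨fun g => ⟨-g.x, -g.y, g.x * g.y - g.z⟩⟩

@[simp] theorem mul_x (g h : Heisenberg) : (g * h).x = g.x + h.x := rfl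
@[simp] theorem mul_y (g h : Heisenberg) : (g * h).y = g.y + h.y := rfl
@[simp] theorem mul_z (g h : Heisenberg) : (g * h).z = g.z + h.z + g.x * h.y := rfl
@[simp] theorem one_x : (1 : Heisenberg).x = 0 := rfl
@[simp] theorem one_y : (1 : Heisenberg).y = 0 := rfl
@[simp] theorem one_z : (1 : Heisenberg).z = 0 := rfl
@[simp] theorem inv_x (g : Heisenberg) : (g⁻¹).x = -g.x := rfl
@[simp] theorem inv_y (g : Heisenberg) : (g⁻¹).y = -g.y := rfl
@[simp] theorem inv_z (g : Heisenberg) : (g⁻¹).z = g.x * g.y - g.z := rfl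

instance : Group Heisenberg :=
  Group.ofLeftAxioms
    (fun a b c => by ext <;> simp <;> ring)
    (fun a => by ext <;> simp)
    (fun a => by ext <;> simp)

/-- The topology of `ℝ³`. -/
instance : TopologicalSpace Heisenberg :=
  TopologicalSpace.induced (fun g => (g.x, g.y, g.z)) inferInstance

/-- The exponential map from the Lie algebra; `(α, β, γ)` is the strictly upper triangular matrix
`N` with entries `α`, `β` above the diagonal and `γ` in the corner, and `exp N = 1 + N + N² / 2`. -/
noncomputable def exp (α β γ : ℝ) : Heisenberg := ⟨α, β, γ + α * β / 2⟩

/-- The discrete Heisenberg group `H₃(ℤ)`. -/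
def lattice : Subgroup Heisenberg where
  carrier := {g | ∃ n m p : ℤ, g = ⟨n, m, p⟩}
  mul_mem' := by
    rintro _ _ ⟨n, m, p, rfl⟩ ⟨n', m', p', rfl⟩
    exact ⟨n + n', m + m', p + p' + n * m', by ext <;> simp⟩
  one_mem' := ⟨0, 0, 0, by ext <;> simp⟩
  inv_mem' := by
    rintro _ ⟨n, m, p, rfl⟩
    exact ⟨-n, -m, n * m - p, by ext <;> simp⟩

/-- The set of all `[x, -x + n, z]` with `x, z` real and `n` an integer. -/
def diagonal : Set Heisenberg := {g | ∃ (x z : ℝ) (n : ℤ), g = ⟨x, -x + n, z⟩}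

/-- The quotient of `diagonal` by `H₃(ℤ)` acting on the right, as a subspace of the
nilmanifold of left cosets `g H₃(ℤ)`. -/
def SubNilmanifold : Type :=
  ((QuotientGroup.mk '' diagonal : Set (Heisenberg ⧸ lattice)) : Type)

instance : TopologicalSpace SubNilmanifold :=
  inferInstanceAs (TopologicalSpace
    ((QuotientGroup.mk '' diagonal : Set (Heisenberg ⧸ lattice)) : Type))

instance : MeasurableSpace SubNilmanifold := borel _

instance : BorelSpace SubNilmanifold := ⟨rfl⟩

/-- The niltranslation by `exp (α, β, γ)`, that is `g H₃(ℤ) ↦ exp (α, β, γ) g H₃(ℤ)`, on the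
sub-nilmanifold, which it preserves since `α + β = 1`. -/
noncomputable def niltranslation (α β γ : ℝ) (h : α + β = 1) :
    SubNilmanifold → SubNilmanifold :=
  fun p => ⟨exp α β γ • p.1, by
    obtain ⟨_, _, ⟨x, z, n, rfl⟩, rfl⟩ := p
    refine ⟨exp α β γ * ⟨x, -x + n, z⟩, ⟨α + x, γ + α * β / 2 + z + α * (-x + n), n + 1, ?_⟩, rfl⟩
    ext
    · simp [exp]
    · simp only [exp, mul_y]
      push_cast
      linarith
    · simp [exp]⟩

end Heisenberg

section Dynamics

/-- Minimality: every forward orbit is dense. -/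
def IsMinimalMap {X : Type*} [TopologicalSpace X] (T : X → X) : Prop :=
  ∀ x : X, Dense (Set.range fun n : ℕ => T^[n] x)

/-- Unique ergodicity: there is exactly one invariant Borel probability measure. -/
def IsUniquelyErgodic {X : Type*} [MeasurableSpace X] (T : X → X) : Prop :=
  ∃! μ : Measure X, IsProbabilityMeasure μ ∧ MeasurePreserving T μ μ

/-- The map `x ↦ T^n x`, where `n` is the least positive integer with `T^n x ∈ A`, on a set `A` to
which each of its points returns. -/
noncomputable def firstReturnMap {X : Type*} (T : X → X) (A : Set X)
    (h : ∀ x ∈ A, ∃ n : ℕ, 0 < n ∧ T^[n] x ∈ A) : A → A :=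
  fun x => ⟨T^[sInf {n : ℕ | 0 < n ∧ T^[n] x.1 ∈ A}] x.1, (Nat.sInf_mem (h x.1 x.2)).2⟩

/-- `T` is self-induced with respect to the probability measure `μ`: there is a measurable set `A`
with `0 < μ A < 1`, to which all of its points return, whose first return map is conjugate to `T`
by a bimeasurable bijection `e : A → X` that carries the normalized restriction of `μ` to `μ`. -/
def IsSelfInduced {X : Type*} [MeasurableSpace X] (T : X → X) (μ : Measure X) : Prop :=
  ∃ A : Set X, MeasurableSet A ∧ 0 < μ A ∧ μ A < 1 ∧
    ∃ (h : ∀ x ∈ A, ∃ n : ℕ, 0 < n ∧ T^[n] x ∈ A) (e : A ≃ᵐ X),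
      (∀ x : A, e (firstReturnMap T A h x) = T (e x)) ∧
      ∀ B : Set X, MeasurableSet B → μ (Subtype.val '' (e ⁻¹' B)) = μ A * μ B

end Dynamics

/-!
In torus coordinates `(x, w)`, `w = z - x y - x (x + 1) / 2`, the sub-nilmanifold becomes
`(ℝ / ℤ)²` and the niltranslation becomes the skew product `(x, w) ↦ (x + α, w - x + γ - α)`. The
number `α` is irrational since the eigenvalue is a quadratic unit other than `± 1`.

*Minimality and unique ergodicity.* Integration against an invariant measure and limiting averages
along an orbit are both invariant states on the continuous functions. Composing a character that is
nontrivial in `w` with the iterates of the skew product gives, up to scalars of modulus one,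
characters whose ratios are nontrivial characters of `x`; these have state zero because `α` is
irrational. So the iterates form an orthonormal sequence on which the state is constant, and Bessel's
inequality forces the constant to vanish (`IsState.torusCharacter_eq_zero`). Hence there is only one
invariant state, Lebesgue measure, which charges every open set.

*Self-induction.* Translating `x` changes the constant `γ - α` arbitrarily, so only `α` matters. A
large even power of the matrix, written as `(a b; c s)` in the basis `(1, -1), (0, 1)`, lies in
`SL₂(ℤ)`, its Möbius action fixes `α`, and its eigenvalue `L = c α + s` exceeds two. It maps the line `x + y = 0` of the plane to a closed curve of
the two-torus that is transverse to the flow in the direction `(α, β)` and has return time `L`;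
flowing the curve until it hits `x + y ∈ ℤ` takes the time `⌈c x⌉ - c x ∈ [0, 1)`, and this hit
moves `x` to `L⁻¹ x + ⌈c x⌉ α`. The resulting map `renormalization`, completed in the fibres by a
quadratic phase, is injective and measurable and conjugates the skew product to its first return to
the image. The return times are at least two because `L > 2`, so the image has measure at most one
half; it is not null because every orbit meets it. Finally `IsSelfEmbedding.measurePreserving_comap`
shows that the pullback of an invariant measure is invariant, so by unique ergodicity it is a
multiple of that measure.
-/

/-! ### States and averages along orbits -/

/-- A state on the `C⋆`-algebra `C(X, ℂ)`: a unital contractive functional satisfying the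
Cauchy–Schwarz inequality. Integrals against probability measures and limits of orbit averages
are both of this form. -/
structure IsState {X : Type*} [TopologicalSpace X] [CompactSpace X] (Λ : C(X, ℂ) →ₗ[ℂ] ℂ) :
    Prop where
  map_one : Λ 1 = 1
  norm_le : ∀ f, ‖Λ f‖ ≤ ‖f‖
  norm_sq_le : ∀ f, ‖Λ f‖ ^ 2 ≤ (Λ (star f * f)).re

/-- Bessel's inequality in the form used below: a state takes the value zero on an infinite
orthonormal sequence on which it is constant. -/
theorem IsState.eq_zero_of_orthonormal {X : Type*} [TopologicalSpace X] [CompactSpace X]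
    {Λ : C(X, ℂ) →ₗ[ℂ] ℂ} (hΛ : IsState Λ) (g : ℕ → C(X, ℂ)) (z : ℂ) (hz : ∀ n, Λ (g n) = z)
    (horth : ∀ m n, Λ (star (g m) * g n) = if m = n then 1 else 0) : z = 0 := by
  have key : ∀ N : ℕ, (N : ℝ) * ‖z‖ ^ 2 ≤ 1 := by
    intro N
    rcases Nat.eq_zero_or_pos N with rfl | hN
    · simp
    have h := hΛ.norm_sq_le (∑ n ∈ Finset.range N, g n)
    rw [star_sum, Finset.sum_mul_sum] at h
    simp only [map_sum, hz, horth, Finset.sum_const, Finset.card_range, nsmul_eq_mul, norm_mul,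
      Complex.norm_natCast] at h
    have h1 : (∑ x ∈ Finset.range N, ∑ y ∈ Finset.range N, (if x = y then (1 : ℂ) else 0)) = N := by
      rw [Finset.sum_congr rfl (g := fun _ => (1 : ℂ))]
      · simp
      · intro x hx
        rw [Finset.sum_ite_eq, if_pos hx]
    rw [h1, Complex.natCast_re, mul_pow, sq, mul_assoc] at h
    have hN' : (0 : ℝ) < N := by exact_mod_cast hN
    exact le_of_mul_le_mul_left (by linarith) hN'
  by_contra hne
  have hpos : 0 < ‖z‖ ^ 2 := by positivity
  obtain ⟨N, hN⟩ := exists_nat_gt (1 / ‖z‖ ^ 2)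
  rw [div_lt_iff₀ hpos] at hN
  linarith [key N]

/-- Integration against a probability measure, as a functional on continuous functions. -/
noncomputable def integralFunctional {X : Type*} [TopologicalSpace X] [CompactSpace X]
    [MeasurableSpace X] [BorelSpace X] (μ : Measure X) [IsFiniteMeasure μ] :
    C(X, ℂ) →ₗ[ℂ] ℂ where
  toFun f := ∫ x, f x ∂μ
  map_add' f g := by
    simp only [ContinuousMap.add_apply]
    exact integral_add (f.continuous.integrable_of_hasCompactSupport (.of_compactSpace _))
      (g.continuous.integrable_of_hasCompactSupport (.of_compactSpace _))
  map_smul' c f := by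
    simp only [ContinuousMap.smul_apply]
    exact integral_smul c _

theorem isState_integralFunctional {X : Type*} [TopologicalSpace X] [CompactSpace X]
    [MeasurableSpace X] [BorelSpace X] (μ : Measure X) [IsProbabilityMeasure μ] :
    IsState (integralFunctional μ) where
  map_one := by simp [integralFunctional]
  norm_le f := by
    refine (norm_integral_le_of_norm_le_const (C := ‖f‖) (.of_forall f.norm_coe_le_norm)).trans ?_
    simp
  norm_sq_le f := by
    have hf : Integrable f μ := f.continuous.integrable_of_hasCompactSupport (.of_compactSpace _)
    have hn : Integrable (fun x => ‖f x‖) μ := hf.norm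
    have hn2 : Integrable (fun x => ‖f x‖ ^ 2) μ :=
      (f.continuous.norm.pow 2).integrable_of_hasCompactSupport (.of_compactSpace _)
    set a := ∫ x, ‖f x‖ ∂μ with ha
    have h1 : ‖∫ x, f x ∂μ‖ ≤ a := norm_integral_le_integral_norm _
    have h2 : a ^ 2 ≤ ∫ x, ‖f x‖ ^ 2 ∂μ := by
      have h0 : 0 ≤ ∫ x, (‖f x‖ - a) ^ 2 ∂μ := integral_nonneg fun x => sq_nonneg _
      have h3 : ∫ x, (‖f x‖ - a) ^ 2 ∂μ = (∫ x, ‖f x‖ ^ 2 ∂μ) - a ^ 2 := by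
        have : ∀ x, (‖f x‖ - a) ^ 2 = ‖f x‖ ^ 2 - 2 * a * ‖f x‖ + a ^ 2 := fun x => by ring
        simp_rw [this]
        have e1 := integral_add (hn2.sub (hn.const_mul (2 * a))) (integrable_const (a ^ 2))
        have e2 := integral_sub hn2 (hn.const_mul (2 * a))
        simp only [Pi.sub_apply] at e1
        rw [e1, e2, integral_const_mul, ← ha, integral_const, probReal_univ]
        simp only [smul_eq_mul, one_mul]
        ring
      linarith
    have h3 : ∫ x, (star f * f) x ∂μ = ((∫ x, ‖f x‖ ^ 2 ∂μ : ℝ) : ℂ) := by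
      rw [← integral_complex_ofReal]
      congr 1
      ext x
      simp [Complex.conj_mul']
    have h4 : (integralFunctional μ (star f * f)).re = ∫ x, ‖f x‖ ^ 2 ∂μ := by
      change (∫ x, (star f * f) x ∂μ).re = _
      rw [h3, Complex.ofReal_re]
    rw [h4]
    exact (pow_le_pow_left₀ (norm_nonneg _) h1 2).trans h2

/-- The average of `f` along the first `n + 1` points of the orbit of `p`. -/
noncomputable def orbitAverage {X : Type*} [TopologicalSpace X] (T : X → X) (p : X) (f : C(X, ℂ))
    (n : ℕ) : ℂ :=
  (∑ i ∈ Finset.range (n + 1), f (T^[i] p)) / ((n : ℂ) + 1)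

theorem norm_orbitAverage_le {X : Type*} [TopologicalSpace X] [CompactSpace X] (T : X → X) (p : X)
    (f : C(X, ℂ)) (n : ℕ) : ‖orbitAverage T p f n‖ ≤ ‖f‖ := by
  have h : ‖((n : ℂ) + 1)‖ = (n : ℝ) + 1 := by
    rw [← Nat.cast_succ, Complex.norm_natCast, Nat.cast_succ]
  rw [orbitAverage, norm_div, h, div_le_iff₀ (by positivity)]
  refine (norm_sum_le _ _).trans ((Finset.sum_le_sum fun i _ => f.norm_coe_le_norm _).trans ?_)
  simp
  linarith

/-- Along an ultrafilter, the averages over the orbit of a point converge to an invariant state. -/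
theorem exists_isState_tendsto_orbitAverage {X : Type*} [TopologicalSpace X] [CompactSpace X]
    (T : C(X, X)) (p : X) :
    ∃ Λ : C(X, ℂ) →ₗ[ℂ] ℂ, IsState Λ ∧ (∀ f : C(X, ℂ), Λ (f.comp T) = Λ f) ∧
      ∀ f : C(X, ℂ), Filter.Tendsto (orbitAverage T p f) (Filter.hyperfilter ℕ) (nhds (Λ f)) := by
  have hlim : ∀ f : C(X, ℂ), ∃ z : ℂ, Filter.Tendsto (orbitAverage T p f) (Filter.hyperfilter ℕ)
      (nhds z) := by
    intro f
    obtain ⟨z, -, hz⟩ := (isCompact_closedBall (0 : ℂ) ‖f‖).ultrafilter_le_nhds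
      ((Filter.hyperfilter ℕ).map (orbitAverage T p f)) (by
        simp only [Ultrafilter.coe_map, Filter.le_principal_iff, Filter.mem_map]
        exact Filter.Eventually.of_forall fun n => by
          simpa using norm_orbitAverage_le T p f n)
    exact ⟨z, hz⟩
  choose L hL using hlim
  let Λ : C(X, ℂ) →ₗ[ℂ] ℂ :=
    { toFun := L
      map_add' := fun f g => by
        refine tendsto_nhds_unique (hL (f + g)) (((hL f).add (hL g)).congr fun n => ?_)
        simp only [orbitAverage, ContinuousMap.add_apply, Finset.sum_add_distrib]
        ring
      map_smul' := fun c f => by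
        refine tendsto_nhds_unique (hL (c • f)) (((hL f).const_mul c).congr fun n => ?_)
        simp only [orbitAverage, ContinuousMap.smul_apply, smul_eq_mul, ← Finset.mul_sum]
        ring }
  refine ⟨Λ, ⟨?_, ?_, ?_⟩, ?_, hL⟩
  · refine tendsto_nhds_unique (hL 1) (tendsto_const_nhds.congr fun n => ?_)
    have : (n : ℂ) + 1 ≠ 0 := Nat.cast_add_one_ne_zero n
    simp [orbitAverage, this]
  · intro f
    exact le_of_tendsto (hL f).norm (.of_forall fun n => norm_orbitAverage_le T p f n)
  · intro f
    refine le_of_tendsto_of_tendsto ((hL f).norm.pow 2)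
      ((Complex.continuous_re.tendsto _).comp (hL (star f * f))) (.of_forall fun n => ?_)
    have h : ‖((n : ℂ) + 1)‖ = (n : ℝ) + 1 := by
      rw [← Nat.cast_succ, Complex.norm_natCast, Nat.cast_succ]
    have h1 : (orbitAverage T p (star f * f) n).re
        = (∑ i ∈ Finset.range (n + 1), ‖f (T^[i] p)‖ ^ 2) / ((n : ℝ) + 1) := by
      rw [← Complex.ofReal_re ((∑ i ∈ Finset.range (n + 1), ‖f (T^[i] p)‖ ^ 2) / ((n : ℝ) + 1))]
      congr 1
      push_cast
      simp [orbitAverage, Complex.conj_mul']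
    have hn : (0 : ℝ) < (n : ℝ) + 1 := by positivity
    simp only [Function.comp_apply, h1]
    rw [orbitAverage, norm_div, h, div_pow, div_le_div_iff₀ (by positivity) hn]
    have h2 : ‖∑ i ∈ Finset.range (n + 1), f (T^[i] p)‖ ^ 2
        ≤ ((n : ℝ) + 1) * ∑ i ∈ Finset.range (n + 1), ‖f (T^[i] p)‖ ^ 2 := by
      refine (pow_le_pow_left₀ (norm_nonneg _) (norm_sum_le _ _) 2).trans ?_
      simpa using sq_sum_le_card_mul_sum_sq (s := Finset.range (n + 1))
        (f := fun i => ‖f (T^[i] p)‖)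
    nlinarith
  · intro f
    -- The two averages differ by a telescoping term of size `O(1 / n)`.
    have h0 : Filter.Tendsto (fun n : ℕ => (f (T^[n + 1] p) - f p) / ((n : ℂ) + 1))
        (Filter.hyperfilter ℕ) (nhds 0) := by
      refine Filter.Tendsto.mono_left ?_ Nat.hyperfilter_le_atTop
      refine squeeze_zero_norm (a := fun n : ℕ => (2 * ‖f‖) * (1 / ((n : ℝ) + 1))) (fun n => ?_) ?_
      · have h : ‖((n : ℂ) + 1)‖ = (n : ℝ) + 1 := by
          rw [← Nat.cast_succ, Complex.norm_natCast, Nat.cast_succ]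
        rw [norm_div, h, mul_one_div]
        gcongr
        have h1 := f.norm_coe_le_norm (T^[n + 1] p)
        have h2 := f.norm_coe_le_norm p
        linarith [norm_sub_le (f (T^[n + 1] p)) (f p)]
      · simpa using tendsto_one_div_add_atTop_nhds_zero_nat.const_mul (2 * ‖f‖)
    have h1 := (hL f).add h0
    rw [add_zero] at h1
    refine tendsto_nhds_unique (hL (f.comp T)) (h1.congr fun n => ?_)
    simp only [orbitAverage, ← add_div]
    congr 1
    have e1 := Finset.sum_range_succ' (fun i => f (T^[i] p)) (n + 1)
    have e2 := Finset.sum_range_succ (fun i => f (T^[i] p)) (n + 1)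
    have e3 : ∑ i ∈ Finset.range (n + 1), (f.comp T) (T^[i] p)
        = ∑ i ∈ Finset.range (n + 1), f (T^[i + 1] p) := by
      refine Finset.sum_congr rfl fun i _ => ?_
      rw [Function.iterate_succ_apply', ContinuousMap.comp_apply]
    rw [e3]
    simp only [Function.iterate_zero, id] at e1
    linear_combination e1 - e2

/-! ### Self-induction from a self-embedding -/

/-- A model of self-induction: an injection `Ψ` of the whole space into itself whose range is met
by every orbit, and for which the first return map to the range is conjugate to `T` through `Ψ`,
with return times `n ≥ 2`. -/
structure IsSelfEmbedding {X : Type*} [MeasurableSpace X] (T : X ≃ᵐ X) (Ψ : X → X) (n : X → ℕ) :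
    Prop where
  measurable : Measurable Ψ
  injective : Function.Injective Ψ
  measurable_time : Measurable n
  two_le : ∀ x, 2 ≤ n x
  map_apply : ∀ x, Ψ (T x) = T^[n x] (Ψ x)
  time_le : ∀ x k, 0 < k → T^[k] (Ψ x) ∈ Set.range Ψ → n x ≤ k
  exists_iterate_eq : ∀ y, ∃ (i j : ℕ) (x : X), T^[i] y = T^[j] (Ψ x)

theorem measure_image_iterate {X : Type*} [MeasurableSpace X] {μ : Measure X} (T : X ≃ᵐ X)
    (hT : MeasurePreserving T μ μ) (k : ℕ) (s : Set X) : μ (T^[k] '' s) = μ s := by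
  induction k with
  | zero => simp
  | succ k ih =>
    rw [Function.iterate_succ', Set.image_comp, ← hT.measure_preimage_equiv,
      Set.preimage_image_eq _ T.injective, ih]

/-- The pullback of an invariant measure along `Ψ` is invariant: cut a set according to its return
time, move each piece by the corresponding iterate, and use that the moved pieces are disjoint. -/
theorem IsSelfEmbedding.measurePreserving_comap {X : Type*} [MeasurableSpace X]
    [StandardBorelSpace X] {T : X ≃ᵐ X} {Ψ : X → X} {n : X → ℕ} (h : IsSelfEmbedding T Ψ n)
    {μ : Measure X} (hT : MeasurePreserving T μ μ) :
    MeasurePreserving T (μ.comap Ψ) (μ.comap Ψ) := by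
  have hemb : MeasurableEmbedding Ψ := h.measurable.measurableEmbedding h.injective
  refine ⟨T.measurable, Measure.ext fun B hB => ?_⟩
  rw [Measure.map_apply T.measurable hB, hemb.comap_apply, hemb.comap_apply]
  have hTB : MeasurableSet (T ⁻¹' B) := T.measurable hB
  have hpiece : ∀ k, MeasurableSet (T ⁻¹' B ∩ n ⁻¹' {k}) := fun k =>
    hTB.inter (h.measurable_time (measurableSet_singleton k))
  have hsource : Ψ '' (T ⁻¹' B) = ⋃ k, Ψ '' (T ⁻¹' B ∩ n ⁻¹' {k}) := by
    rw [← Set.image_iUnion, ← Set.inter_iUnion, ← Set.preimage_iUnion, Set.iUnion_of_singleton]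
    simp
  have hmove : ∀ k, T^[k] '' (Ψ '' (T ⁻¹' B ∩ n ⁻¹' {k})) = Ψ '' (T '' (T ⁻¹' B ∩ n ⁻¹' {k})) := by
    intro k
    rw [Set.image_image, Set.image_image]
    refine Set.image_congr fun x hx => ?_
    rw [h.map_apply, hx.2]
  have htarget : Ψ '' B = ⋃ k, T^[k] '' (Ψ '' (T ⁻¹' B ∩ n ⁻¹' {k})) := by
    simp_rw [hmove]
    rw [← Set.image_iUnion, ← Set.image_iUnion, ← Set.inter_iUnion, ← Set.preimage_iUnion,
      Set.iUnion_of_singleton]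
    simp [Set.image_preimage_eq _ T.surjective]
  have hdisj : Pairwise (Function.onFun Disjoint fun k => T ⁻¹' B ∩ n ⁻¹' {k}) := by
    intro i j hij
    refine Set.disjoint_left.2 fun x hi hj => hij ?_
    rw [← hi.2, ← hj.2]
  rw [hsource, htarget, measure_iUnion, measure_iUnion]
  · simp_rw [measure_image_iterate T hT]
  · intro i j hij
    simp only [Function.onFun, hmove]
    exact (Set.disjoint_image_iff h.injective).2
      ((Set.disjoint_image_iff T.injective).2 (hdisj hij))
  · intro k
    rw [hmove]
    exact hemb.measurableSet_image.2 (T.measurableSet_image.2 (hpiece k))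
  · intro i j hij
    exact (Set.disjoint_image_iff h.injective).2 (hdisj hij)
  · exact fun k => hemb.measurableSet_image.2 (hpiece k)

theorem IsSelfEmbedding.isSelfInduced {X : Type*} [MeasurableSpace X] [StandardBorelSpace X]
    {T : X ≃ᵐ X} {Ψ : X → X} {n : X → ℕ} (h : IsSelfEmbedding T Ψ n)
    (hue : IsUniquelyErgodic T) {μ : Measure X} [IsProbabilityMeasure μ]
    (hT : MeasurePreserving T μ μ) : IsSelfInduced T μ := by
  have hemb : MeasurableEmbedding Ψ := h.measurable.measurableEmbedding h.injective
  have hA : MeasurableSet (Set.range Ψ) := hemb.measurableSet_range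
  have hreturn : ∀ x, T^[n x] (Ψ x) ∈ Set.range Ψ := fun x => ⟨T x, h.map_apply x⟩
  have hpos : μ (Set.range Ψ) ≠ 0 := by
    intro h0
    have hcover : (Set.univ : Set X) ⊆ ⋃ i : ℕ, ⋃ j : ℕ, T^[i] ⁻¹' (T^[j] '' Set.range Ψ) := by
      intro y _
      obtain ⟨i, j, x, hx⟩ := h.exists_iterate_eq y
      exact Set.mem_iUnion₂.2 ⟨i, j, Ψ x, ⟨x, rfl⟩, hx.symm⟩
    have hnull : μ (⋃ i : ℕ, ⋃ j : ℕ, T^[i] ⁻¹' (T^[j] '' Set.range Ψ)) = 0 := by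
      refine measure_iUnion_null fun i => measure_iUnion_null fun j => ?_
      refine (hT.iterate i).quasiMeasurePreserving.preimage_null ?_
      rw [measure_image_iterate T hT, h0]
    have := measure_mono_null hcover hnull
    simp at this
  have hlt : μ (Set.range Ψ) < 1 := by
    -- Return times are at least two, so the range is disjoint from its preimage.
    have hdisj : Disjoint (Set.range Ψ) (T ⁻¹' Set.range Ψ) := by
      refine Set.disjoint_left.2 ?_
      rintro _ ⟨x, rfl⟩ hx
      have := h.time_le x 1 one_pos hx
      have := h.two_le x
      omega
    have hle : μ (Set.range Ψ) + μ (Set.range Ψ) ≤ 1 := by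
      nth_rewrite 2 [← hT.measure_preimage hA.nullMeasurableSet]
      rw [← measure_union hdisj (T.measurable hA)]
      exact prob_le_one
    by_contra hge
    rw [not_lt] at hge
    have : (1 : ENNReal) + 1 ≤ 1 := (add_le_add hge hge).trans hle
    norm_num at this
  set a := μ (Set.range Ψ) with ha
  have hatop : a ≠ ⊤ := measure_ne_top _ _
  have hcomap : ∀ B : Set X, μ (Ψ '' B) = a * μ B := by
    intro B
    have huniv : μ.comap Ψ Set.univ = a := by rw [hemb.comap_apply, Set.image_univ]
    have hprob : IsProbabilityMeasure (a⁻¹ • μ.comap Ψ) := by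
      refine ⟨?_⟩
      rw [Measure.smul_apply, huniv, smul_eq_mul, ENNReal.inv_mul_cancel hpos hatop]
    have heq : a⁻¹ • μ.comap Ψ = μ :=
      hue.unique ⟨hprob, (h.measurePreserving_comap hT).smul_measure _⟩ ⟨inferInstance, hT⟩
    have hB : (a⁻¹ • μ.comap Ψ) B = μ B := by rw [heq]
    rw [Measure.smul_apply, smul_eq_mul, hemb.comap_apply] at hB
    rw [← hB, ← mul_assoc, ENNReal.mul_inv_cancel hpos hatop, one_mul]
  have hret : ∀ x ∈ Set.range Ψ, ∃ k : ℕ, 0 < k ∧ T^[k] x ∈ Set.range Ψ := by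
    rintro _ ⟨x, rfl⟩
    exact ⟨n x, by linarith [h.two_le x], hreturn x⟩
  have hsymm : ∀ x, hemb.equivRange.symm ⟨Ψ x, x, rfl⟩ = x := fun x => by
    rw [MeasurableEquiv.symm_apply_eq, hemb.equivRange_apply]
  refine ⟨Set.range Ψ, hA, pos_iff_ne_zero.2 hpos, hlt, hret, hemb.equivRange.symm, ?_, ?_⟩
  · rintro ⟨_, x, rfl⟩
    have htime : sInf {k : ℕ | 0 < k ∧ T^[k] (Ψ x) ∈ Set.range Ψ} = n x := by
      refine le_antisymm (Nat.sInf_le ⟨by linarith [h.two_le x], hreturn x⟩) ?_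
      refine le_csInf ⟨n x, by linarith [h.two_le x], hreturn x⟩ ?_
      rintro k ⟨hk, hk'⟩
      exact h.time_le x k hk hk'
    rw [MeasurableEquiv.symm_apply_eq, hsymm]
    refine Subtype.ext ?_
    rw [hemb.equivRange_apply]
    change T^[sInf {k : ℕ | 0 < k ∧ T^[k] (Ψ x) ∈ Set.range Ψ}] (Ψ x) = Ψ (T x)
    rw [htime, h.map_apply]
  · intro B _
    rw [← hcomap B]
    congr 1
    ext y
    constructor
    · rintro ⟨⟨_, x, rfl⟩, hx, rfl⟩
      rw [Set.mem_preimage, hsymm] at hx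
      exact ⟨x, hx, rfl⟩
    · rintro ⟨x, hx, rfl⟩
      exact ⟨⟨Ψ x, x, rfl⟩, by rwa [Set.mem_preimage, hsymm], rfl⟩

theorem iterate_conj {X Y : Type*} (e : Y ≃ X) (T : X → X) (k : ℕ) (y : Y) :
    (fun y => e.symm (T (e y)))^[k] y = e.symm (T^[k] (e y)) := by
  induction k with
  | zero => simp
  | succ k ih => rw [Function.iterate_succ_apply', ih, Function.iterate_succ_apply']; simp

theorem IsSelfEmbedding.conj {X Y : Type*} [MeasurableSpace X] [MeasurableSpace Y] {T : X ≃ᵐ X}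
    {Ψ : X → X} {n : X → ℕ} (h : IsSelfEmbedding T Ψ n) (e : Y ≃ᵐ X) :
    IsSelfEmbedding ((e.trans T).trans e.symm) (fun y => e.symm (Ψ (e y))) (fun y => n (e y)) := by
  have hit : ∀ k y, ((e.trans T).trans e.symm)^[k] y = e.symm (T^[k] (e y)) :=
    iterate_conj e.toEquiv T
  refine ⟨?_, ?_, ?_, fun y => h.two_le _, ?_, ?_, ?_⟩
  · exact e.symm.measurable.comp (h.measurable.comp e.measurable)
  · exact e.symm.injective.comp (h.injective.comp e.injective)
  · exact h.measurable_time.comp e.measurable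
  · intro y
    rw [hit]
    simp [h.map_apply]
  · intro y k hk
    rw [hit]
    rintro ⟨z, hz⟩
    have hz' : Ψ (e z) = T^[k] (Ψ (e y)) := by simpa using hz
    exact h.time_le _ k hk ⟨_, hz'⟩
  · intro y
    obtain ⟨i, j, x, hx⟩ := h.exists_iterate_eq (e y)
    refine ⟨i, j, e.symm x, ?_⟩
    rw [hit, hit]
    simp [hx]

theorem IsUniquelyErgodic.conj {X Y : Type*} [MeasurableSpace X] [MeasurableSpace Y] {T : X ≃ᵐ X}
    (h : IsUniquelyErgodic T) (e : Y ≃ᵐ X) : IsUniquelyErgodic ((e.trans T).trans e.symm) := by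
  obtain ⟨μ, ⟨hμ, hT⟩, huniq⟩ := h
  have hμe : MeasurePreserving e.symm μ (μ.map e.symm) := e.symm.measurable.measurePreserving μ
  have hμe' : MeasurePreserving e (μ.map e.symm) μ := by
    simpa using hμe.symm
  refine ⟨μ.map e.symm, ⟨Measure.isProbabilityMeasure_map e.symm.measurable.aemeasurable,
    hμe.comp (hT.comp hμe')⟩, ?_⟩
  rintro ν ⟨hν, hS⟩
  have hνe : MeasurePreserving e ν (ν.map e) := e.measurable.measurePreserving ν
  have hνe' : MeasurePreserving e.symm (ν.map e) ν := by
    simpa using hνe.symm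
  have h1 : MeasurePreserving T (ν.map e) (ν.map e) := by
    have := hνe.comp (hS.comp hνe')
    convert this using 1
    ext x
    simp
  rw [← huniq _ ⟨Measure.isProbabilityMeasure_map e.measurable.aemeasurable, h1⟩]
  exact hνe'.map_eq.symm

theorem IsMinimalMap.conj {X Y : Type*} [TopologicalSpace X] [TopologicalSpace Y] {T : X → X}
    (h : IsMinimalMap T) (e : Y ≃ₜ X) : IsMinimalMap fun y => e.symm (T (e y)) := by
  intro y
  have hit : (fun k : ℕ => (fun y => e.symm (T (e y)))^[k] y)
      = e.symm ∘ fun k : ℕ => T^[k] (e y) := by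
    ext k
    exact iterate_conj e.toEquiv T k y
  rw [hit, Set.range_comp]
  exact (e.symm.surjective.denseRange.dense_image e.symm.continuous (h (e y)))

/-! ### Minimality and unique ergodicity of the skew product -/

/-- The torus on which the niltranslation is modelled by a skew product. -/
abbrev Torus : Type := UnitAddCircle × UnitAddCircle

/-- The skew product `(x, w) ↦ (x + a, w - x + c)` over the rotation by `a`. -/
def skewProduct (a c : UnitAddCircle) : Torus ≃ₜ Torus where
  toFun p := (p.1 + a, p.2 - p.1 + c)
  invFun p := (p.1 - a, p.2 + (p.1 - a) - c)
  left_inv p := by ext <;> dsimp only <;> abel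
  right_inv p := by ext <;> dsimp only <;> abel
  continuous_toFun := by fun_prop
  continuous_invFun := by fun_prop

@[simp] theorem skewProduct_apply (a c : UnitAddCircle) (p : Torus) :
    skewProduct a c p = (p.1 + a, p.2 - p.1 + c) := rfl

/-- The character `(x, w) ↦ exp (2πi (k x + l w))` of the torus. -/
noncomputable def torusCharacter (k l : ℤ) : C(Torus, ℂ) where
  toFun p := fourier k p.1 * fourier l p.2
  continuous_toFun := by fun_prop

theorem torusCharacter_apply (k l : ℤ) (p : Torus) :
    torusCharacter k l p = fourier k p.1 * fourier l p.2 := rfl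

theorem fourier_apply_add (k : ℤ) (x y : UnitAddCircle) :
    fourier k (x + y) = fourier k x * fourier k y := by
  simp [fourier_apply, smul_add, AddCircle.toCircle_add]

theorem norm_fourier_apply (k : ℤ) (x : UnitAddCircle) : ‖fourier k x‖ = 1 := by
  rw [fourier_apply, Circle.norm_coe]

theorem star_torusCharacter_mul (k l k' l' : ℤ) :
    star (torusCharacter k l) * torusCharacter k' l' = torusCharacter (k' - k) (l' - l) := by
  ext p
  simp only [ContinuousMap.mul_apply, ContinuousMap.star_apply, torusCharacter_apply, star_mul',
    RCLike.star_def, ← fourier_neg, sub_eq_add_neg, fourier_add]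
  ring

theorem exists_torusCharacter_comp_skewProduct (a c : UnitAddCircle) (k l : ℤ) :
    ∃ z : ℂ, ‖z‖ = 1 ∧
      (torusCharacter k l).comp (skewProduct a c : C(Torus, Torus))
        = z • torusCharacter (k - l) l := by
  refine ⟨fourier k a * fourier l c,
    by rw [norm_mul, norm_fourier_apply, norm_fourier_apply, one_mul], ?_⟩
  ext p
  change fourier k (p.1 + a) * fourier l (p.2 - p.1 + c)
    = fourier k a * fourier l c * (fourier (k - l) p.1 * fourier l p.2)
  rw [fourier_apply_add, fourier_apply_add, sub_eq_add_neg k l, fourier_add, fourier_neg,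
    sub_eq_add_neg, fourier_apply_add]
  have h : fourier l (-p.1) = (starRingEnd ℂ) (fourier l p.1) := by
    rw [← fourier_neg, fourier_apply, fourier_apply, smul_neg, neg_smul]
  rw [h]
  ring

/-- Two states on the torus with the same Fourier coefficients agree. -/
theorem IsState.ext_torusCharacter {Λ Λ' : C(Torus, ℂ) →ₗ[ℂ] ℂ} (h : IsState Λ) (h' : IsState Λ')
    (heq : ∀ k l, Λ (torusCharacter k l) = Λ' (torusCharacter k l)) (f : C(Torus, ℂ)) :
    Λ f = Λ' f := by
  let e : (Fin 2 → UnitAddCircle) ≃ₜ Torus := Homeomorph.finTwoArrow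
  let E : C(UnitAddTorus (Fin 2), ℂ) →ₗ[ℂ] C(Torus, ℂ) :=
    { toFun := fun g => g.comp (e.symm : C(Torus, Fin 2 → UnitAddCircle))
      map_add' := fun _ _ => rfl
      map_smul' := fun _ _ => rfl }
  have hE : ∀ g, ‖E g‖ ≤ ‖g‖ := fun g =>
    (ContinuousMap.norm_le _ (norm_nonneg _)).2 fun x => g.norm_coe_le_norm _
  let F : C(UnitAddTorus (Fin 2), ℂ) →L[ℂ] ℂ := (Λ ∘ₗ E).mkContinuous 1 fun g => by
    rw [one_mul]; exact (h.norm_le _).trans (hE g)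
  let F' : C(UnitAddTorus (Fin 2), ℂ) →L[ℂ] ℂ := (Λ' ∘ₗ E).mkContinuous 1 fun g => by
    rw [one_mul]; exact (h'.norm_le _).trans (hE g)
  have hF : F = F' := by
    refine ContinuousLinearMap.ext_on (s := Set.range UnitAddTorus.mFourier) ?_ ?_
    · rw [Submodule.dense_iff_topologicalClosure_eq_top]
      exact UnitAddTorus.span_mFourier_closure_eq_top
    · rintro _ ⟨n, rfl⟩
      have : E (UnitAddTorus.mFourier n) = torusCharacter (n 0) (n 1) := by
        ext p
        simp [E, e, UnitAddTorus.mFourier, torusCharacter_apply]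
      change Λ (E _) = Λ' (E _)
      rw [this, heq]
  have hf : E (f.comp (e : C(Fin 2 → UnitAddCircle, Torus))) = f := by
    ext p
    simp [E]
  rw [← hf]
  exact congrArg (fun G : C(UnitAddTorus (Fin 2), ℂ) →L[ℂ] ℂ => G (f.comp _)) hF

theorem fourier_ne_one_of_irrational {α : ℝ} (hα : Irrational α) {k : ℤ} (hk : k ≠ 0) :
    fourier k (α : UnitAddCircle) ≠ 1 := by
  intro h
  rw [fourier_apply, ← AddCircle.coe_zsmul, Circle.coe_eq_one,
    ← AddCircle.toCircle_zero (T := (1 : ℝ))] at h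
  have h1 := AddCircle.injective_toCircle (one_ne_zero) h
  rw [AddCircle.coe_eq_zero_iff] at h1
  obtain ⟨m, hm⟩ := h1
  simp only [zsmul_eq_mul, mul_one] at hm
  refine (hα.intCast_mul hk).ne_int m ?_
  exact hm.symm

/-- All nontrivial Fourier coefficients of an invariant state vanish: those in the base because
the rotation is irrational, the others because composing with the iterates of the skew product
turns a character into an orthonormal sequence. -/
theorem IsState.torusCharacter_eq_zero {α : ℝ} (hα : Irrational α) {c : UnitAddCircle}
    {Λ : C(Torus, ℂ) →ₗ[ℂ] ℂ} (h : IsState Λ)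
    (hinv : ∀ f : C(Torus, ℂ), Λ (f.comp (skewProduct α c : C(Torus, Torus))) = Λ f) {k l : ℤ}
    (hkl : k ≠ 0 ∨ l ≠ 0) : Λ (torusCharacter k l) = 0 := by
  have hbase : ∀ k : ℤ, k ≠ 0 → Λ (torusCharacter k 0) = 0 := by
    intro k hk
    have h1 : (torusCharacter k 0).comp (skewProduct α c : C(Torus, Torus))
        = fourier k (α : UnitAddCircle) • torusCharacter k 0 := by
      ext p
      change fourier k (p.1 + (α : UnitAddCircle)) * fourier 0 (p.2 - p.1 + c)
        = fourier k (α : UnitAddCircle) * (fourier k p.1 * fourier 0 p.2)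
      rw [fourier_apply_add, fourier_zero, fourier_zero]
      ring
    have h2 := hinv (torusCharacter k 0)
    rw [h1, map_smul, smul_eq_mul] at h2
    have h3 : (fourier k (α : UnitAddCircle) - 1) * Λ (torusCharacter k 0) = 0 := by
      linear_combination h2
    exact (mul_eq_zero.1 h3).resolve_left (sub_ne_zero.2 (fourier_ne_one_of_irrational hα hk))
  rcases eq_or_ne l 0 with rfl | hl
  · exact hbase k (hkl.resolve_right (by simp))
  have hseq : ∀ n : ℕ, ∃ z : ℂ, ‖z‖ = 1 ∧
      Λ (z • torusCharacter (k - n * l) l) = Λ (torusCharacter k l) := by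
    intro n
    induction n with
    | zero => exact ⟨1, by simp⟩
    | succ n ih =>
      obtain ⟨z, hz, hzΛ⟩ := ih
      obtain ⟨z', hz', hcomp⟩ := exists_torusCharacter_comp_skewProduct (α : UnitAddCircle) c
        (k - n * l) l
      refine ⟨z * z', by rw [norm_mul, hz, hz', one_mul], ?_⟩
      rw [← hzΛ, map_smul, map_smul, ← hinv (torusCharacter (k - n * l) l), hcomp, map_smul]
      have : k - (n + 1 : ℕ) * l = k - n * l - l := by push_cast; ring
      rw [this]
      simp [mul_assoc]
  choose z hz hzΛ using hseq
  refine h.eq_zero_of_orthonormal (fun n => z n • torusCharacter (k - n * l) l) _ hzΛ fun m n => ?_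
  rw [star_smul, smul_mul_smul_comm, star_torusCharacter_mul, sub_self, map_smul, smul_eq_mul]
  split_ifs with hmn
  · subst hmn
    rw [sub_self]
    have : torusCharacter 0 0 = 1 := by
      ext p
      simp [torusCharacter_apply]
    rw [this, h.map_one, RCLike.star_def, Complex.conj_mul', hz]
    simp
  · have : k - n * l - (k - m * l) ≠ 0 := by
      have h1 : k - n * l - (k - m * l) = ((m : ℤ) - n) * l := by ring
      rw [h1]
      exact mul_ne_zero (sub_ne_zero.2 (by exact_mod_cast hmn)) hl
    rw [hbase _ this, mul_zero]

theorem IsState.eq_of_skewProduct_invariant {α : ℝ} (hα : Irrational α) {c : UnitAddCircle}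
    {Λ Λ' : C(Torus, ℂ) →ₗ[ℂ] ℂ} (h : IsState Λ) (h' : IsState Λ')
    (hinv : ∀ f : C(Torus, ℂ), Λ (f.comp (skewProduct α c : C(Torus, Torus))) = Λ f)
    (hinv' : ∀ f : C(Torus, ℂ), Λ' (f.comp (skewProduct α c : C(Torus, Torus))) = Λ' f)
    (f : C(Torus, ℂ)) : Λ f = Λ' f := by
  refine h.ext_torusCharacter h' (fun k l => ?_) f
  by_cases hkl : k ≠ 0 ∨ l ≠ 0
  · rw [h.torusCharacter_eq_zero hα hinv hkl, h'.torusCharacter_eq_zero hα hinv' hkl]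
  · push Not at hkl
    have : torusCharacter k l = 1 := by
      ext p
      simp [torusCharacter_apply, hkl.1, hkl.2]
    rw [this, h.map_one, h'.map_one]

instance isProbabilityMeasure_volume_torus : IsProbabilityMeasure (volume : Measure Torus) := by
  have : IsProbabilityMeasure (volume : Measure UnitAddCircle) := ⟨UnitAddCircle.measure_univ⟩
  rw [Measure.volume_eq_prod]
  infer_instance

theorem measurePreserving_skewProduct (a c : UnitAddCircle) :
    MeasurePreserving (skewProduct a c) (volume : Measure Torus) volume := by
  rw [Measure.volume_eq_prod]
  refine MeasurePreserving.skew_product (f := fun x : UnitAddCircle => x + a)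
    (g := fun x w => w - x + c) (measurePreserving_add_right _ a) (by fun_prop)
    (.of_forall fun x => ?_)
  have : (fun w : UnitAddCircle => w - x + c) = fun w => w + (c - x) := by
    ext w; abel
  rw [this]
  exact (measurePreserving_add_right _ (c - x)).map_eq

theorem integralFunctional_comp {X : Type*} [TopologicalSpace X] [CompactSpace X]
    [MeasurableSpace X] [BorelSpace X] {μ : Measure X} [IsFiniteMeasure μ] (T : X ≃ₜ X)
    (hT : MeasurePreserving T μ μ) (f : C(X, ℂ)) :
    integralFunctional μ (f.comp (T : C(X, X))) = integralFunctional μ f :=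
  hT.integral_comp T.measurableEmbedding f

theorem isUniquelyErgodic_skewProduct {α : ℝ} (hα : Irrational α) (c : UnitAddCircle) :
    IsUniquelyErgodic (skewProduct α c) := by
  refine ⟨volume, ⟨inferInstance, measurePreserving_skewProduct _ _⟩, ?_⟩
  rintro μ ⟨hμ, hT⟩
  refine ext_of_forall_integral_eq_of_IsFiniteMeasure fun f => ?_
  have h := (isState_integralFunctional μ).eq_of_skewProduct_invariant hα
    (isState_integralFunctional volume) (integralFunctional_comp _ hT)
    (integralFunctional_comp _ (measurePreserving_skewProduct α c))
    ⟨fun x => (f x : ℂ), by fun_prop⟩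
  have h' : ∫ x, (f x : ℂ) ∂μ = ∫ x, (f x : ℂ) := h
  rw [integral_complex_ofReal, integral_complex_ofReal] at h'
  exact_mod_cast h'

/-- If an orbit missed an open set, its limiting averages would vanish on a bump function supported
there, whereas they are given by Lebesgue measure. -/
theorem isMinimalMap_skewProduct {α : ℝ} (hα : Irrational α) (c : UnitAddCircle) :
    IsMinimalMap (skewProduct α c) := by
  intro p
  rw [dense_iff_inter_open]
  rintro U hU ⟨u, hu⟩
  by_contra hne
  obtain ⟨b, hb1, hb0, hbc, hb⟩ := exists_continuous_one_zero_of_isCompact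
    (isCompact_singleton (x := u)) hU.isClosed_compl
    (Set.disjoint_singleton_left.2 fun h => h hu)
  obtain ⟨Λ, hΛ, hinv, hlim⟩ :=
    exists_isState_tendsto_orbitAverage (skewProduct α c : C(Torus, Torus)) p
  let f : C(Torus, ℂ) := ⟨fun x => (b x : ℂ), by fun_prop⟩
  have hzero : Λ f = 0 := by
    refine tendsto_nhds_unique (hlim f) (tendsto_const_nhds.congr fun n => ?_)
    rw [orbitAverage, Finset.sum_eq_zero, zero_div]
    intro i _
    have : (skewProduct α c)^[i] p ∈ Uᶜ := fun hmem => hne ⟨_, hmem, i, rfl⟩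
    exact Complex.ofReal_eq_zero.2 (hb0 this)
  have h := hΛ.eq_of_skewProduct_invariant hα (isState_integralFunctional volume) hinv
    (integralFunctional_comp _ (measurePreserving_skewProduct α c)) f
  have h' : ∫ x, (b x : ℂ) = 0 := h.symm.trans hzero
  rw [integral_complex_ofReal, Complex.ofReal_eq_zero] at h'
  have hu1 : b u = 1 := hb1 rfl
  have := b.continuous.integral_pos_of_hasCompactSupport_nonneg_nonzero
    (μ := (volume : Measure Torus)) hbc (fun x => (hb x).1) (x := u) (by rw [hu1]; exact one_ne_zero)
  linarith

/-! ### Renormalization of the skew product -/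

theorem UnitAddCircle.coe_eq_coe_iff {x y : ℝ} :
    (x : UnitAddCircle) = (y : UnitAddCircle) ↔ ∃ m : ℤ, x - y = m := by
  rw [← sub_eq_zero, ← AddCircle.coe_sub, AddCircle.coe_eq_zero_iff]
  simp [eq_comm]

/-- The representative in `[0, 1)` of a point of the circle. -/
noncomputable def circleLift (x : UnitAddCircle) : ℝ := AddCircle.equivIco 1 0 x

theorem coe_circleLift (x : UnitAddCircle) : (circleLift x : UnitAddCircle) = x :=
  (AddCircle.equivIco 1 0).symm_apply_apply x

theorem circleLift_coe (x : ℝ) : circleLift x = Int.fract x := by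
  simp [circleLift, AddCircle.coe_equivIco_mk_apply]

theorem measurable_circleLift : Measurable circleLift :=
  measurable_subtype_coe.comp (AddCircle.measurableEquivIco 1 0).measurable

/-- The `j`-th iterate of the skew product `(x, w) ↦ (x + α, w - x + κ)`, for `j` an integer. -/
noncomputable def skewIterate (α κ : ℝ) (j : ℤ) (p : Torus) : Torus :=
  (p.1 + ((j * α : ℝ) : UnitAddCircle),
    p.2 - j • p.1 + ((j * κ - j * (j - 1) / 2 * α : ℝ) : UnitAddCircle))

theorem skewIterate_add (α κ : ℝ) (i j : ℤ) (p : Torus) :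
    skewIterate α κ (i + j) p = skewIterate α κ i (skewIterate α κ j p) := by
  obtain ⟨x, w⟩ := p
  obtain ⟨x, rfl⟩ := QuotientAddGroup.mk_surjective x
  obtain ⟨w, rfl⟩ := QuotientAddGroup.mk_surjective w
  simp only [skewIterate, Prod.mk.injEq, ← AddCircle.coe_add, ← AddCircle.coe_sub,
    ← AddCircle.coe_zsmul]
  refine ⟨congrArg _ ?_, congrArg _ ?_⟩
  · push_cast; ring
  · simp only [zsmul_eq_mul]; push_cast; ring

theorem skewIterate_zero (α κ : ℝ) (p : Torus) : skewIterate α κ 0 p = p := by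
  simp [skewIterate]

theorem skewIterate_natCast (α κ : ℝ) (n : ℕ) (p : Torus) :
    skewIterate α κ n p = (skewProduct α κ)^[n] p := by
  induction n with
  | zero => simpa using skewIterate_zero α κ p
  | succ n ih =>
    rw [Function.iterate_succ_apply', ← ih, Nat.cast_succ, add_comm, skewIterate_add]
    simp [skewIterate]

theorem skewIterate_injective (α κ : ℝ) (j : ℤ) : Function.Injective (skewIterate α κ j) := by
  intro p q h
  have := congrArg (skewIterate α κ (-j)) h
  simpa [← skewIterate_add, skewIterate_zero] using this

theorem measurable_skewIterate (α κ : ℝ) (j : ℤ) : Measurable (skewIterate α κ j) := by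
  have : Continuous (skewIterate α κ j) := by
    unfold skewIterate
    fun_prop
  exact this.measurable

/-- The number `α` is fixed by the Möbius transformation of `(a b; c s) ∈ SL₂(ℤ)`, and the
eigenvalue `c α + s` of the eigenvector `(α, 1)` exceeds two. -/
structure IsExpandingFixedPoint (α : ℝ) (a b c s : ℤ) : Prop where
  det_eq : a * s - b * c = 1
  fixed : (c * α + s) * α = a * α + b
  two_lt : 2 < c * α + s

namespace IsExpandingFixedPoint

variable {α : ℝ} {a b c s : ℤ}

theorem eigenvalue_mul (h : IsExpandingFixedPoint α a b c s) :
    (c * α + s) * (a - c * α) = 1 := by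
  have h1 : (a : ℝ) * s - b * c = 1 := by exact_mod_cast h.det_eq
  linear_combination (-(c : ℝ)) * h.fixed + h1

theorem conj_mul (h : IsExpandingFixedPoint α a b c s) :
    (a - c * α) * α = s * α - b := by
  linear_combination -h.fixed

/-- A coincidence modulo one between two points of the contracted circle, moved along the rotation,
comes from a coincidence on the original circle: apply the inverse matrix. -/
theorem coincidence (h : IsExpandingFixedPoint α a b c s) {x y : ℝ} {m l : ℤ}
    (hl : (a - c * α) * x + m * α - (a - c * α) * y = l) :
    x + (m * a - l * c) * α - y = l * s - m * b ∧
      (m * a - l * c) * (c * α + s) = m - c * (x - y) := by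
  have h1 := h.eigenvalue_mul
  constructor
  · linear_combination (c * α + s) * hl - (x - y) * h1 - m * h.fixed
  · linear_combination (c : ℝ) * (c * α + s) * hl + (m - c * (x - y)) * h1

/-- The phase `x ↦ p₂ x² + p₁ x` and the constant `κ` that make the contracted circle renormalize
the skew product are found by comparing coefficients; the two conditions left over are linear in
`(p₁, κ)` and independent because the eigenvalue is not `1`. -/
theorem exists_phase (h : IsExpandingFixedPoint α a b c s) :
    ∃ p₁ κ : ℝ, ∀ (x : ℝ) (ε : ℤ), ∃ m : ℤ,
      ((a - c * α) * c / 2 * (x + α - ε) ^ 2 + p₁ * (x + α - ε) - x + κ)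
        - ((a - c * α) * c / 2 * x ^ 2 + p₁ * x - (s + c * ε) * ((a - c * α) * x)
          + ((s + c * ε) * κ - (s + c * ε) * (s + c * ε - 1) / 2 * α)) = m := by
  have h1 := h.eigenvalue_mul
  have hne : (c : ℝ) * α + s - 1 ≠ 0 := by linarith [h.two_lt]
  set p₂ : ℝ := (a - c * α) * c / 2 with hp₂
  obtain ⟨r, hr⟩ : ∃ r : ℝ, r = c * a / 2 - 2 * α * p₂ + α * (2 * s * c - c) / 2 := ⟨_, rfl⟩
  obtain ⟨κ, hκ⟩ : ∃ κ : ℝ,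
      (c * α + s - 1) * κ = p₂ * α ^ 2 + r * α + s * (s - 1) / 2 * α :=
    ⟨_, mul_div_cancel₀ _ hne⟩
  refine ⟨r - c * κ, κ, fun x ε => ?_⟩
  obtain ⟨m, hm⟩ : ∃ m : ℤ, ε * (ε - 1) = m + m := Int.even_mul_pred_self ε
  refine ⟨c * a * m, ?_⟩
  have hm' : (ε : ℝ) * (ε - 1) = m + m := by exact_mod_cast hm
  push_cast
  linear_combination x * h1 - hκ - ε * hr + (c * a / 2 : ℝ) * hm' + (x * (α - ε) * 2 + ε ^ 2) * hp₂

end IsExpandingFixedPoint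

/-- The self-embedding of the torus that realizes the renormalization by `(a b; c s)`: the base
circle is cut at `0`, contracted by the eigenvalue `a - c α = (c α + s)⁻¹` and moved along the
rotation by `⌈c x⌉` steps; the fibres are turned by the phase `(a - c α) c x² / 2 + p₁ x`. -/
noncomputable def renormalization (α : ℝ) (a c : ℤ) (p₁ κ : ℝ) (p : Torus) : Torus :=
  skewIterate α κ ⌈c * circleLift p.1⌉
    (((a - c * α) * circleLift p.1 : ℝ), p.2 +
      (((a - c * α) * c / 2 * circleLift p.1 ^ 2 + p₁ * circleLift p.1 : ℝ) : UnitAddCircle))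

/-- The return time to the range of `renormalization`, as an integer. -/
noncomputable def returnTime (α : ℝ) (c s : ℤ) (p : Torus) : ℤ :=
  ⌈c * circleLift (p.1 + α)⌉ - ⌈c * circleLift p.1⌉ + (s + c * ⌊circleLift p.1 + α⌋)

theorem circleLift_add_coe (α : ℝ) (x : UnitAddCircle) :
    circleLift (x + α) = circleLift x + α - ⌊circleLift x + α⌋ := by
  have : x + α = ((circleLift x + α : ℝ) : UnitAddCircle) := by
    rw [AddCircle.coe_add, coe_circleLift]
  rw [this, circleLift_coe]
  rfl

/-- The return time is the eigenvalue plus the increment of the hitting time `⌈c x⌉ - c x`. -/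
theorem returnTime_eq (α : ℝ) (c s : ℤ) (p : Torus) :
    (returnTime α c s p : ℝ) = c * α + s
      + (⌈c * circleLift (p.1 + α)⌉ - c * circleLift (p.1 + α))
      - (⌈c * circleLift p.1⌉ - c * circleLift p.1) := by
  rw [returnTime]
  have := circleLift_add_coe α p.1
  push_cast
  linear_combination (c : ℝ) * this

theorem renormalization_fst (α : ℝ) (a c : ℤ) (p₁ κ : ℝ) (p : Torus) :
    (renormalization α a c p₁ κ p).1
      = (((a - c * α) * circleLift p.1 + ⌈c * circleLift p.1⌉ * α : ℝ) : UnitAddCircle) := by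
  exact (AddCircle.coe_add 1 _ _).symm

theorem hittingTime_mem (x : ℝ) : 0 ≤ (⌈x⌉ : ℝ) - x ∧ (⌈x⌉ : ℝ) - x < 1 :=
  ⟨by linarith [Int.le_ceil x], by linarith [Int.ceil_lt_add_one x]⟩

theorem measurable_renormalization (α : ℝ) (a c : ℤ) (p₁ κ : ℝ) :
    Measurable (renormalization α a c p₁ κ) := by
  have hlift : Measurable fun p : Torus => circleLift p.1 :=
    measurable_circleLift.comp measurable_fst
  have hcoe : Measurable fun x : ℝ => (x : UnitAddCircle) := AddCircle.measurable_mk'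
  have h1 : Measurable fun p : Torus => ((⌈c * circleLift p.1⌉,
      ((((a - c * α) * circleLift p.1 : ℝ) : UnitAddCircle), p.2 +
      (((a - c * α) * c / 2 * circleLift p.1 ^ 2 + p₁ * circleLift p.1 : ℝ) : UnitAddCircle))) :
      ℤ × Torus) := by
    refine Measurable.prodMk (Int.measurable_ceil.comp (hlift.const_mul _)) (Measurable.prodMk
      (hcoe.comp (hlift.const_mul _)) (measurable_snd.add (hcoe.comp ?_)))
    exact ((hlift.pow_const 2).const_mul _).add (hlift.const_mul _)
  have h2 : Measurable fun q : ℤ × Torus => skewIterate α κ q.1 q.2 :=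
    measurable_from_prod_countable_right fun j => measurable_skewIterate α κ j
  exact h2.comp h1

theorem measurable_returnTime (α : ℝ) (c s : ℤ) : Measurable (returnTime α c s) := by
  have hlift : Measurable fun p : Torus => circleLift p.1 :=
    measurable_circleLift.comp measurable_fst
  have hlift' : Measurable fun p : Torus => circleLift (p.1 + α) :=
    measurable_circleLift.comp (measurable_fst.add_const _)
  refine ((Int.measurable_ceil.comp (hlift'.const_mul _)).sub
    (Int.measurable_ceil.comp (hlift.const_mul _))).add (Measurable.const_add ?_ _)
  exact (Int.measurable_floor.comp (hlift.add_const _)).const_mul _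

theorem IsExpandingFixedPoint.renormalization_skewProduct {α : ℝ} {a b c s : ℤ}
    (h : IsExpandingFixedPoint α a b c s) {p₁ κ : ℝ}
    (hphase : ∀ (x : ℝ) (ε : ℤ), ∃ m : ℤ,
      ((a - c * α) * c / 2 * (x + α - ε) ^ 2 + p₁ * (x + α - ε) - x + κ)
        - ((a - c * α) * c / 2 * x ^ 2 + p₁ * x - (s + c * ε) * ((a - c * α) * x)
          + ((s + c * ε) * κ - (s + c * ε) * (s + c * ε - 1) / 2 * α)) = m) (p : Torus) :
    renormalization α a c p₁ κ (skewProduct α κ p)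
      = skewIterate α κ (returnTime α c s p) (renormalization α a c p₁ κ p) := by
  obtain ⟨x₀, w⟩ := p
  obtain ⟨w, rfl⟩ := QuotientAddGroup.mk_surjective w
  rw [renormalization, renormalization, ← skewIterate_add, returnTime]
  simp only [skewProduct_apply]
  have hsplit : ∀ i j N : ℤ, i - j + N + j = i + N := fun i j N => by ring
  rw [hsplit, skewIterate_add]
  congr 1
  have hx := circleLift_add_coe α x₀
  have hx₀ := coe_circleLift x₀
  set x := circleLift x₀ with hxdef
  set ε := ⌊x + α⌋ with hε
  rw [hx, ← hx₀, skewIterate]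
  simp only [Prod.mk.injEq, ← AddCircle.coe_add, ← AddCircle.coe_sub, ← AddCircle.coe_zsmul]
  constructor
  · refine UnitAddCircle.coe_eq_coe_iff.2 ⟨-b - ε * a, ?_⟩
    push_cast
    linear_combination h.conj_mul
  · obtain ⟨m, hm⟩ := hphase x ε
    refine UnitAddCircle.coe_eq_coe_iff.2 ⟨m, ?_⟩
    simp only [zsmul_eq_mul]
    push_cast
    linear_combination hm

theorem IsExpandingFixedPoint.two_le_returnTime {α : ℝ} {a b c s : ℤ}
    (h : IsExpandingFixedPoint α a b c s) (p : Torus) : 2 ≤ returnTime α c s p := by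
  have h1 := returnTime_eq α c s p
  have h2 := hittingTime_mem (c * circleLift (p.1 + α))
  have h3 := hittingTime_mem (c * circleLift p.1)
  have h4 := h.two_lt
  have : (1 : ℝ) < returnTime α c s p := by linarith [h2.1, h3.2]
  have : (1 : ℤ) < returnTime α c s p := by exact_mod_cast this
  omega

theorem IsExpandingFixedPoint.renormalization_injective {α : ℝ} {a b c s : ℤ}
    (h : IsExpandingFixedPoint α a b c s) (p₁ κ : ℝ) :
    Function.Injective (renormalization α a c p₁ κ) := by
  rintro ⟨x₀, w⟩ ⟨y₀, v⟩ heq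
  have hfst := congrArg Prod.fst heq
  rw [renormalization_fst, renormalization_fst, UnitAddCircle.coe_eq_coe_iff] at hfst
  obtain ⟨l, hl⟩ := hfst
  have hx := hittingTime_mem (c * circleLift x₀)
  have hy := hittingTime_mem (c * circleLift y₀)
  obtain ⟨h1, h2⟩ := h.coincidence (x := circleLift x₀) (y := circleLift y₀)
    (m := ⌈c * circleLift x₀⌉ - ⌈c * circleLift y₀⌉) (l := l) (by push_cast; linear_combination hl)
  set i := ⌈c * circleLift x₀⌉
  set j := ⌈c * circleLift y₀⌉
  have h3 := h.two_lt
  obtain ⟨q, hq⟩ : ∃ q : ℤ, q = (i - j) * a - l * c := ⟨_, rfl⟩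
  have hq' : (q : ℝ) = (i - j) * a - l * c := by rw [hq]; push_cast; ring
  push_cast at h1 h2
  rw [← hq'] at h1 h2
  have hq0 : q = 0 := by
    have hlt : (q : ℝ) < 1 := by
      by_contra hge
      nlinarith [hx.1, hx.2, hy.1, hy.2]
    have hgt : (-1 : ℝ) < q := by
      by_contra hge
      nlinarith [hx.1, hx.2, hy.1, hy.2]
    have : q < 1 := by exact_mod_cast hlt
    have : -1 < q := by exact_mod_cast hgt
    omega
  have hxy : x₀ = y₀ := by
    rw [← coe_circleLift x₀, ← coe_circleLift y₀, UnitAddCircle.coe_eq_coe_iff]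
    refine ⟨l * s - (i - j) * b, ?_⟩
    push_cast
    rw [← h1, hq0]
    simp
  subst hxy
  have := skewIterate_injective _ _ _ heq
  simp only [Prod.mk.injEq, add_left_inj, true_and] at this
  rw [this]

theorem IsExpandingFixedPoint.returnTime_le {α : ℝ} {a b c s : ℤ}
    (h : IsExpandingFixedPoint α a b c s) (p₁ κ : ℝ) (p : Torus) {k : ℤ} (hk : 0 < k)
    (hmem : skewIterate α κ k (renormalization α a c p₁ κ p)
      ∈ Set.range (renormalization α a c p₁ κ)) : returnTime α c s p ≤ k := by
  obtain ⟨r, hr⟩ := hmem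
  have hfst := congrArg Prod.fst hr
  rw [skewIterate, renormalization_fst, renormalization_fst, ← AddCircle.coe_add, eq_comm,
    UnitAddCircle.coe_eq_coe_iff] at hfst
  obtain ⟨l, hl⟩ := hfst
  have hx := hittingTime_mem (c * circleLift p.1)
  have hy := hittingTime_mem (c * circleLift r.1)
  have hz := hittingTime_mem (c * circleLift (p.1 + α))
  have hn := returnTime_eq α c s p
  have h3 := h.two_lt
  obtain ⟨h1, h2⟩ := h.coincidence (x := circleLift p.1) (y := circleLift r.1)
    (m := ⌈c * circleLift p.1⌉ + k - ⌈c * circleLift r.1⌉) (l := l)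
    (by push_cast; linear_combination hl)
  set i := ⌈c * circleLift p.1⌉
  set j := ⌈c * circleLift r.1⌉
  obtain ⟨q, hq⟩ : ∃ q : ℤ, q = (i + k - j) * a - l * c := ⟨_, rfl⟩
  have hq' : (q : ℝ) = (i + k - j) * a - l * c := by rw [hq]; push_cast; ring
  push_cast at h1 h2
  rw [← hq'] at h1 h2
  have hk' : (1 : ℝ) ≤ k := by exact_mod_cast hk
  have hqpos : 0 < q := by
    by_contra hle
    have : (q : ℝ) ≤ 0 := by exact_mod_cast not_lt.1 hle
    nlinarith [hx.1, hx.2, hy.1, hy.2]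
  rcases eq_or_lt_of_le (Int.add_one_le_of_lt hqpos) with hq1 | hq2
  · -- The next visit: the return point is the image of the successor.
    have hq1' : (q : ℝ) = 1 := by
      rw [← hq1]; simp
    rw [hq1', one_mul] at h1
    have hr1 : r.1 = p.1 + α := by
      rw [← coe_circleLift r.1, ← coe_circleLift p.1, ← AddCircle.coe_add, eq_comm,
        UnitAddCircle.coe_eq_coe_iff]
      refine ⟨l * s - (i + k - j) * b, ?_⟩
      push_cast
      linear_combination h1
    rw [← hr1] at hn
    have : (returnTime α c s p : ℝ) = k := by
      rw [hn]
      rw [hq1'] at h2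
      linear_combination h2
    exact le_of_eq (by exact_mod_cast this)
  · have hq2' : (2 : ℝ) ≤ q := by
      have : (2 : ℤ) ≤ q := by omega
      exact_mod_cast this
    have : (returnTime α c s p : ℝ) ≤ k := by
      nlinarith [hx.1, hx.2, hy.1, hy.2, hz.1, hz.2]
    exact_mod_cast this

theorem IsExpandingFixedPoint.exists_renormalization_eq {α : ℝ} {a b c s : ℤ}
    (h : IsExpandingFixedPoint α a b c s) (p₁ κ : ℝ) (p : Torus) :
    ∃ (e : ℤ) (r : Torus), skewIterate α κ e p = renormalization α a c p₁ κ r := by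
  obtain ⟨y₀, v⟩ := p
  obtain ⟨y, rfl⟩ := QuotientAddGroup.mk_surjective y₀
  have hx : circleLift (((c * α + s) * y : ℝ) : UnitAddCircle)
      = (c * α + s) * y - ⌊(c * α + s) * y⌋ := circleLift_coe _
  set x₀ : UnitAddCircle := (((c * α + s) * y : ℝ) : UnitAddCircle)
  set q := ⌊(c * α + s) * y⌋
  set e : ℤ := ⌈c * circleLift x₀⌉ + q * c with he
  refine ⟨e, (x₀, (skewIterate α κ e (y, v)).2 - (renormalization α a c p₁ κ (x₀, 0)).2), ?_⟩
  refine Prod.ext ?_ ?_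
  · rw [renormalization_fst, skewIterate]
    change (y : UnitAddCircle) + _ = _
    rw [← AddCircle.coe_add, UnitAddCircle.coe_eq_coe_iff]
    refine ⟨q * a, ?_⟩
    simp only
    rw [he]
    push_cast
    linear_combination (-(a - c * α : ℝ)) * hx - y * h.eigenvalue_mul
  · simp only [renormalization, skewIterate]
    abel

theorem IsExpandingFixedPoint.exists_isSelfEmbedding {α : ℝ} {a b c s : ℤ}
    (h : IsExpandingFixedPoint α a b c s) :
    ∃ (κ : ℝ) (Ψ : Torus → Torus) (n : Torus → ℕ),
      IsSelfEmbedding (skewProduct α κ).toMeasurableEquiv Ψ n := by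
  obtain ⟨p₁, κ, hphase⟩ := h.exists_phase
  have htime : ∀ p, (((returnTime α c s p).toNat : ℕ) : ℤ) = returnTime α c s p := fun p =>
    Int.toNat_of_nonneg (by linarith [h.two_le_returnTime p])
  refine ⟨κ, renormalization α a c p₁ κ, fun p => (returnTime α c s p).toNat,
    measurable_renormalization _ _ _ _ _, h.renormalization_injective _ _, ?_, ?_, ?_, ?_, ?_⟩
  · exact (measurable_of_countable Int.toNat).comp (measurable_returnTime α c s)
  · intro p
    have := h.two_le_returnTime p
    omega
  · intro p
    simp only [Homeomorph.toMeasurableEquiv_coe]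
    rw [← skewIterate_natCast, htime, h.renormalization_skewProduct hphase]
  · intro p k hk hmem
    simp only [Homeomorph.toMeasurableEquiv_coe] at hmem
    rw [← skewIterate_natCast] at hmem
    have := h.returnTime_le p₁ κ p (by exact_mod_cast hk) hmem
    omega
  · intro p
    obtain ⟨e, r, hr⟩ := h.exists_renormalization_eq p₁ κ p
    refine ⟨e.toNat, (-e).toNat, r, ?_⟩
    simp only [Homeomorph.toMeasurableEquiv_coe]
    rw [← skewIterate_natCast, ← skewIterate_natCast, ← hr, ← skewIterate_add]
    congr 1
    omega

/-- Translating the base conjugates skew products with different constants. -/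
theorem skewProduct_conj (a c c' : UnitAddCircle) (p : Torus) :
    skewProduct a c' p = ((Homeomorph.addRight (c - c')).prodCongr (.refl UnitAddCircle)).symm
      (skewProduct a c ((Homeomorph.addRight (c - c')).prodCongr (.refl UnitAddCircle) p)) := by
  rw [Homeomorph.eq_symm_apply]
  refine Prod.ext ?_ ?_
  · change p.1 + a + (c - c') = p.1 + (c - c') + a
    abel
  · change p.2 - p.1 + c' = p.2 - (p.1 + (c - c')) + c
    abel

theorem exists_isSelfEmbedding_skewProduct {α : ℝ} {a b c s : ℤ}
    (h : IsExpandingFixedPoint α a b c s) (κ : UnitAddCircle) :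
    ∃ (Ψ : Torus → Torus) (n : Torus → ℕ),
      IsSelfEmbedding (skewProduct α κ).toMeasurableEquiv Ψ n := by
  obtain ⟨κ₀, Ψ, n, hΨ⟩ := h.exists_isSelfEmbedding
  let e : Torus ≃ᵐ Torus := ((Homeomorph.addRight ((κ₀ : UnitAddCircle) - κ)).prodCongr
    (.refl UnitAddCircle)).toMeasurableEquiv
  have heq : (skewProduct α κ).toMeasurableEquiv
      = (e.trans (skewProduct α κ₀).toMeasurableEquiv).trans e.symm :=
    MeasurableEquiv.ext (funext fun p => skewProduct_conj α κ₀ κ p)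
  rw [heq]
  exact ⟨_, _, hΨ.conj e⟩

/-! ### Torus coordinates on the sub-nilmanifold -/

namespace Heisenberg

theorem continuous_coord : Continuous fun g : Heisenberg => (g.x, g.y, g.z) :=
  continuous_induced_dom

theorem continuous_x : Continuous Heisenberg.x :=
  continuous_fst.comp continuous_coord

theorem continuous_y : Continuous Heisenberg.y :=
  continuous_fst.comp (continuous_snd.comp continuous_coord)

theorem continuous_z : Continuous Heisenberg.z :=
  continuous_snd.comp (continuous_snd.comp continuous_coord)

theorem continuous_mk {X : Type*} [TopologicalSpace X] {f g h : X → ℝ} (hf : Continuous f)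
    (hg : Continuous g) (hh : Continuous h) :
    Continuous fun t => (⟨f t, g t, h t⟩ : Heisenberg) :=
  continuous_induced_rng.2 (hf.prodMk (hg.prodMk hh))

instance : ContinuousMul Heisenberg where
  continuous_mul := by
    have hx := continuous_x
    have hy := continuous_y
    have hz := continuous_z
    refine continuous_mk (f := fun p : Heisenberg × Heisenberg => p.1.x + p.2.x)
      (g := fun p => p.1.y + p.2.y) (h := fun p => p.1.z + p.2.z + p.1.x * p.2.y) ?_ ?_ ?_ <;>
    fun_prop

/-- Torus coordinates of `[x, y, z]`. On `diagonal` they are invariant under right multiplication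
by the lattice. -/
noncomputable def torusCoord (g : Heisenberg) : Torus :=
  ((g.x : UnitAddCircle), ((g.z - g.x * g.y - g.x * (g.x + 1) / 2 : ℝ) : UnitAddCircle))

theorem continuous_torusCoord : Continuous torusCoord := by
  have hx := continuous_x
  have hy := continuous_y
  have hz := continuous_z
  have hcoe : Continuous fun x : ℝ => (x : UnitAddCircle) := AddCircle.continuous_mk' 1
  exact (hcoe.comp hx).prodMk (hcoe.comp (by fun_prop))

theorem mem_diagonal_iff {g : Heisenberg} : g ∈ diagonal ↔ ∃ n : ℤ, g.x + g.y = n := by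
  constructor
  · rintro ⟨x, z, n, rfl⟩
    exact ⟨n, by simp⟩
  · rintro ⟨n, hn⟩
    refine ⟨g.x, g.z, n, ?_⟩
    ext <;> simp
    linarith

theorem mk_mem_image_diagonal_iff {g : Heisenberg} :
    (g : Heisenberg ⧸ lattice) ∈ (QuotientGroup.mk '' diagonal : Set (Heisenberg ⧸ lattice))
      ↔ g ∈ diagonal := by
  refine ⟨?_, fun h => ⟨g, h, rfl⟩⟩
  rintro ⟨h, hh, heq⟩
  obtain ⟨n, m, p, hnmp⟩ := QuotientGroup.eq.1 heq
  obtain ⟨k, hk⟩ := mem_diagonal_iff.1 hh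
  have hg : g = h * ⟨n, m, p⟩ := by rw [← hnmp, mul_inv_cancel_left]
  refine mem_diagonal_iff.2 ⟨k + n + m, ?_⟩
  rw [hg]
  push_cast
  simp only [mul_x, mul_y]
  linarith

/-- Two points of `diagonal` lie in the same coset exactly when their torus coordinates agree. -/
theorem torusCoord_eq_iff {g h : Heisenberg} (hg : g ∈ diagonal) (hh : h ∈ diagonal) :
    torusCoord g = torusCoord h ↔ (g : Heisenberg ⧸ lattice) = h := by
  obtain ⟨k, hk⟩ := mem_diagonal_iff.1 hg
  obtain ⟨k', hk'⟩ := mem_diagonal_iff.1 hh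
  rw [QuotientGroup.eq, torusCoord, torusCoord, Prod.mk.injEq, UnitAddCircle.coe_eq_coe_iff,
    UnitAddCircle.coe_eq_coe_iff]
  have hgy : g.y = k - g.x := by linarith
  have hhy : h.y = k' - h.x := by linarith
  constructor
  · rintro ⟨⟨n, hn⟩, ⟨p, hp⟩⟩
    obtain ⟨m, hm⟩ : ∃ m : ℤ, n * (n - 1) = m + m := Int.even_mul_pred_self n
    have hm' : (n : ℝ) * (n - 1) = m + m := by exact_mod_cast hm
    refine ⟨-n, k' - k + n, -(m + n) - p - n * k', ?_⟩
    have hgx : g.x = h.x + n := by linarith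
    rw [hgy, hhy, hgx] at hp
    ext
    · simp [hgx]
    · simp only [mul_y, inv_y]
      push_cast
      linarith
    · simp only [mul_z, inv_z, inv_x]
      push_cast
      rw [hgy, hhy, hgx]
      linear_combination -hm' / 2 - hp
  · rintro ⟨n, m, p, hnmp⟩
    have h1 := congrArg Heisenberg.x hnmp
    have h2 := congrArg Heisenberg.y hnmp
    have h3 := congrArg Heisenberg.z hnmp
    simp only [mul_x, inv_x, mul_y, inv_y, mul_z, inv_z] at h1 h2 h3
    obtain ⟨r, hr⟩ : ∃ r : ℤ, n * (n - 1) = r + r := Int.even_mul_pred_self n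
    have hr' : (n : ℝ) * (n - 1) = r + r := by exact_mod_cast hr
    refine ⟨⟨-n, by push_cast; linarith⟩, ⟨-r - p + n * k', ?_⟩⟩
    have hhx : h.x = g.x + n := by linarith
    rw [hgy, hhy, hhx] at h3 ⊢
    push_cast
    linear_combination -hr' / 2 - h3

theorem torusCoord_surjOn (p : Torus) : ∃ g ∈ diagonal, torusCoord g = p := by
  obtain ⟨x, w⟩ := p
  obtain ⟨x, rfl⟩ := QuotientAddGroup.mk_surjective x
  obtain ⟨w, rfl⟩ := QuotientAddGroup.mk_surjective w
  refine ⟨⟨x, -x, w - x * x + x * (x + 1) / 2⟩, mem_diagonal_iff.2 ⟨0, by simp⟩, ?_⟩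
  refine Prod.ext rfl ?_
  change ((_ : ℝ) : UnitAddCircle) = (w : UnitAddCircle)
  congr 1
  ring

/-- The coset of a point of `diagonal`. -/
def toSubNilmanifold (g : diagonal) : SubNilmanifold :=
  ⟨(g.1 : Heisenberg ⧸ lattice), g.1, g.2, rfl⟩

theorem toSubNilmanifold_surjective : Function.Surjective toSubNilmanifold := by
  rintro ⟨_, g, hg, rfl⟩
  exact ⟨⟨g, hg⟩, rfl⟩

/-- The subspace topology agrees with the quotient topology because `diagonal` is saturated. -/
theorem isQuotientMap_toSubNilmanifold : Topology.IsQuotientMap toSubNilmanifold := by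
  have h1 : Topology.IsQuotientMap ((QuotientGroup.mk '' diagonal :
      Set (Heisenberg ⧸ lattice)).restrictPreimage (QuotientGroup.mk : Heisenberg → _)) :=
    (QuotientGroup.isOpenQuotientMap_mk.restrictPreimage _).isQuotientMap
  let e : diagonal ≃ₜ ((QuotientGroup.mk : Heisenberg → Heisenberg ⧸ lattice) ⁻¹'
      (QuotientGroup.mk '' diagonal)) :=
    Homeomorph.setCongr (Set.ext fun g => mk_mem_image_diagonal_iff.symm)
  exact h1.comp e.isQuotientMap

instance : CompactSpace SubNilmanifold := by
  let f : ℝ × ℝ → diagonal := fun q => ⟨⟨q.1, -q.1, q.2⟩, mem_diagonal_iff.2 ⟨0, by simp⟩⟩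
  have hf : Continuous f := (continuous_mk (by fun_prop) (by fun_prop) (by fun_prop)).subtype_mk _
  have hcompact : IsCompact ((toSubNilmanifold ∘ f) '' (Set.Icc 0 1 ×ˢ Set.Icc 0 1)) :=
    (isCompact_Icc.prod isCompact_Icc).image (isQuotientMap_toSubNilmanifold.continuous.comp hf)
  refine ⟨hcompact.of_isClosed_subset isClosed_univ fun p _ => ?_⟩
  obtain ⟨⟨g, hg⟩, rfl⟩ := toSubNilmanifold_surjective p
  -- Both torus coordinates have representatives in `[0, 1)`.
  set x := Int.fract g.x with hx
  set t := g.z - g.x * g.y - g.x * (g.x + 1) / 2 + x * (x + 1) / 2 - x * x with ht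
  refine ⟨(x, Int.fract t), ⟨⟨Int.fract_nonneg _, (Int.fract_lt_one _).le⟩,
    ⟨Int.fract_nonneg _, (Int.fract_lt_one _).le⟩⟩, Subtype.ext ?_⟩
  refine (torusCoord_eq_iff (f (x, Int.fract t)).2 hg).1 (Prod.ext ?_ ?_)
  · exact UnitAddCircle.coe_eq_coe_iff.2 ⟨-⌊g.x⌋, by
      simp only [f, hx, Int.fract]; push_cast; ring⟩
  · refine UnitAddCircle.coe_eq_coe_iff.2 ⟨-⌊t⌋, ?_⟩
    simp only [f]
    push_cast
    rw [← Int.self_sub_floor t]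
    rw [ht]
    ring

/-- The torus coordinates on the sub-nilmanifold. -/
noncomputable def subNilmanifoldCoord (p : SubNilmanifold) : Torus :=
  torusCoord (Function.surjInv toSubNilmanifold_surjective p).1

theorem subNilmanifoldCoord_toSubNilmanifold (g : diagonal) :
    subNilmanifoldCoord (toSubNilmanifold g) = torusCoord g.1 :=
  (torusCoord_eq_iff (Subtype.property _) g.2).2
    (congrArg Subtype.val (Function.surjInv_eq toSubNilmanifold_surjective (toSubNilmanifold g)))

theorem continuous_subNilmanifoldCoord : Continuous subNilmanifoldCoord := by
  rw [isQuotientMap_toSubNilmanifold.continuous_iff]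
  have : subNilmanifoldCoord ∘ toSubNilmanifold = fun g => torusCoord g.1 :=
    funext subNilmanifoldCoord_toSubNilmanifold
  rw [this]
  exact continuous_torusCoord.comp continuous_subtype_val

theorem bijective_subNilmanifoldCoord : Function.Bijective subNilmanifoldCoord := by
  constructor
  · intro p q hpq
    obtain ⟨g, rfl⟩ := toSubNilmanifold_surjective p
    obtain ⟨h, rfl⟩ := toSubNilmanifold_surjective q
    rw [subNilmanifoldCoord_toSubNilmanifold, subNilmanifoldCoord_toSubNilmanifold] at hpq
    exact Subtype.ext ((torusCoord_eq_iff g.2 h.2).1 hpq)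
  · intro p
    obtain ⟨g, hg, rfl⟩ := torusCoord_surjOn p
    exact ⟨toSubNilmanifold ⟨g, hg⟩, subNilmanifoldCoord_toSubNilmanifold _⟩

/-- The sub-nilmanifold is a torus. -/
noncomputable def subNilmanifoldHomeomorph : SubNilmanifold ≃ₜ Torus :=
  Continuous.homeoOfEquivCompactToT2
    (f := Equiv.ofBijective subNilmanifoldCoord bijective_subNilmanifoldCoord)
    continuous_subNilmanifoldCoord

theorem subNilmanifoldHomeomorph_apply (p : SubNilmanifold) :
    subNilmanifoldHomeomorph p = subNilmanifoldCoord p := rfl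

/-- In torus coordinates a niltranslation is a skew product over the rotation by `α`. -/
theorem subNilmanifoldHomeomorph_niltranslation (α β γ : ℝ) (h : α + β = 1) (p : SubNilmanifold) :
    subNilmanifoldHomeomorph (niltranslation α β γ h p)
      = skewProduct α ((γ - α : ℝ) : UnitAddCircle) (subNilmanifoldHomeomorph p) := by
  obtain ⟨⟨g, hg⟩, rfl⟩ := toSubNilmanifold_surjective p
  obtain ⟨k, hk⟩ := mem_diagonal_iff.1 hg
  have hmem : exp α β γ * g ∈ diagonal := by
    refine mem_diagonal_iff.2 ⟨k + 1, ?_⟩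
    simp only [exp, mul_x, mul_y]
    push_cast
    linarith
  have heq : niltranslation α β γ h (toSubNilmanifold ⟨g, hg⟩)
      = toSubNilmanifold ⟨exp α β γ * g, hmem⟩ := rfl
  rw [heq, subNilmanifoldHomeomorph_apply, subNilmanifoldHomeomorph_apply,
    subNilmanifoldCoord_toSubNilmanifold, subNilmanifoldCoord_toSubNilmanifold]
  have hβ : β = 1 - α := by linarith
  simp only [torusCoord, skewProduct_apply, exp, mul_x, mul_y, mul_z, ← AddCircle.coe_add,
    ← AddCircle.coe_sub]
  refine Prod.ext ?_ ?_
  · simp only [add_comm]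
  · refine congrArg (fun t : ℝ => (t : UnitAddCircle)) ?_
    rw [hβ]
    ring

end Heisenberg

/-! ### The eigenvalue and its eigenvector -/

theorem charpoly_eq_zero_of_hasEigenvalue (M : Matrix (Fin 2) (Fin 2) ℤ) {lam : ℂ}
    (heig : Module.End.HasEigenvalue (Matrix.toLin' (M.map (Int.cast : ℤ → ℂ))) lam) :
    lam ^ 2 - M.trace * lam + M.det = 0 := by
  obtain ⟨v, hv⟩ := heig.exists_hasEigenvector
  have h := hv.apply_eq_smul
  rw [Matrix.toLin'_apply] at h
  have h0 := congrFun h 0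
  have h1 := congrFun h 1
  simp only [Matrix.mulVec, dotProduct, Fin.sum_univ_two, Matrix.map_apply, Pi.smul_apply,
    smul_eq_mul] at h0 h1
  rw [Matrix.trace_fin_two, Matrix.det_fin_two]
  push_cast
  by_contra hne
  refine hv.2 (funext fun i => ?_)
  fin_cases i
  · refine (mul_eq_zero.1 (?_ : _ * v 0 = 0)).resolve_left hne
    linear_combination ((M 1 1 : ℂ) - lam) * h0 - (M 0 1 : ℂ) * h1
  · refine (mul_eq_zero.1 (?_ : _ * v 1 = 0)).resolve_left hne
    linear_combination ((M 0 0 : ℂ) - lam) * h1 - (M 1 0 : ℂ) * h0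

/-- A nonreal root would have modulus one, as its product with its conjugate is the determinant. -/
theorem exists_real_eq_of_one_lt_norm {t d : ℤ} (hd : |d| = 1) {lam : ℂ}
    (hchar : lam ^ 2 - t * lam + d = 0) (hlam : 1 < ‖lam‖) :
    ∃ l : ℝ, (l : ℂ) = lam ∧ l ^ 2 - t * l + d = 0 ∧ 1 < |l| := by
  have him : lam.im = 0 := by
    by_contra hne
    have hre := congrArg Complex.re hchar
    have him := congrArg Complex.im hchar
    simp [sq] at hre him
    have h1 : 2 * lam.re = t := by
      refine mul_right_cancel₀ hne ?_
      linarith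
    have h2 : Complex.normSq lam = d := by
      rw [Complex.normSq_apply]
      linear_combination -hre + lam.re * h1
    have h3 : 1 < Complex.normSq lam := by
      rw [Complex.normSq_eq_norm_sq]
      nlinarith
    have h4 : (d : ℝ) ≤ 1 := by
      have := le_abs_self d
      rw [hd] at this
      exact_mod_cast this
    linarith
  have hl : ((lam.re : ℝ) : ℂ) = lam := Complex.ext (by simp) (by simp [him])
  refine ⟨lam.re, hl, ?_, ?_⟩
  · rw [← hl] at hchar
    exact_mod_cast hchar
  · rw [← hl, Complex.norm_real] at hlam
    simpa using hlam

theorem irrational_of_quadratic {t d : ℤ} (hd : |d| = 1) {l : ℝ} (h : l ^ 2 - t * l + d = 0)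
    (hl : 1 < |l|) : Irrational l := by
  rintro ⟨q, rfl⟩
  have hq : q ^ 2 - t * q + d = 0 := by exact_mod_cast h
  have hint : IsIntegral ℤ q := by
    refine ⟨Polynomial.X ^ 2 + (Polynomial.C (-t) * Polynomial.X + Polynomial.C d), ?_, ?_⟩
    · exact Polynomial.monic_X_pow_add (Polynomial.degree_linear_le.trans_lt (by norm_num))
    · simp only [Polynomial.eval₂_add, Polynomial.eval₂_mul, Polynomial.eval₂_pow,
        Polynomial.eval₂_X, Polynomial.eval₂_C]
      simp only [eq_intCast]
      push_cast
      linarith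
  obtain ⟨z, rfl⟩ := IsIntegrallyClosed.isIntegral_iff.1 hint
  have hz : z * (t - z) = d := by
    have : (z : ℚ) ^ 2 - t * z + d = 0 := hq
    have : z ^ 2 - t * z + d = 0 := by exact_mod_cast this
    linarith
  have hunit : |z| * |t - z| = 1 := by rw [← abs_mul, hz, hd]
  have hz1 : |z| = 1 := Int.eq_one_of_mul_eq_one_right (abs_nonneg z) hunit
  have : |((z : ℚ) : ℝ)| = 1 := by
    rw [Rat.cast_intCast]
    exact_mod_cast hz1
  exact absurd hl (by simp only [eq_intCast, this, lt_irrefl, not_false_iff])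

theorem pow_mulVec_eigenvector (M : Matrix (Fin 2) (Fin 2) ℤ) {l α β : ℝ}
    (h0 : M 0 0 * α + M 0 1 * β = l * α) (h1 : M 1 0 * α + M 1 1 * β = l * β) (n : ℕ) :
    (M ^ n) 0 0 * α + (M ^ n) 0 1 * β = l ^ n * α ∧
      (M ^ n) 1 0 * α + (M ^ n) 1 1 * β = l ^ n * β := by
  induction n with
  | zero => simp
  | succ n ih =>
    simp only [pow_succ, Matrix.mul_apply, Fin.sum_univ_two]
    push_cast
    constructor
    · linear_combination ((M ^ n) 0 0 : ℝ) * h0 + ((M ^ n) 0 1 : ℝ) * h1 + l * ih.1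
    · linear_combination ((M ^ n) 1 0 : ℝ) * h0 + ((M ^ n) 1 1 : ℝ) * h1 + l * ih.2

/-- In the basis `(1, -1), (0, 1)` of `ℤ²` the eigenvector `(α, 1 - α)` becomes `(α, 1)`, and a large
even power of the matrix provides an expanding element of `SL₂(ℤ)` that fixes `α`. -/
theorem exists_isExpandingFixedPoint (M : Matrix (Fin 2) (Fin 2) ℤ) (hdet : |M.det| = 1)
    {l α β : ℝ} (hl : 1 < |l|) (hαβ : α + β = 1) (h0 : M 0 0 * α + M 0 1 * β = l * α)
    (h1 : M 1 0 * α + M 1 1 * β = l * β) :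
    ∃ a b c s : ℤ, IsExpandingFixedPoint α a b c s := by
  obtain ⟨k, hk⟩ := pow_unbounded_of_one_lt 2 ((one_lt_sq_iff_one_lt_abs l).2 hl)
  obtain ⟨e0, e1⟩ := pow_mulVec_eigenvector M h0 h1 (2 * k)
  have hN : (M ^ (2 * k)).det = 1 := by
    rw [Matrix.det_pow, pow_mul, ← sq_abs, hdet, one_pow, one_pow]
  rw [← pow_mul] at hk
  set N := M ^ (2 * k)
  rw [Matrix.det_fin_two] at hN
  have hβ : β = 1 - α := by linarith
  rw [hβ] at e0 e1
  have heig : ((N 0 0 + N 1 0 - N 0 1 - N 1 1 : ℤ) : ℝ) * α + ((N 0 1 + N 1 1 : ℤ) : ℝ)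
      = l ^ (2 * k) := by
    push_cast
    linear_combination e0 + e1
  refine ⟨N 0 0 - N 0 1, N 0 1, N 0 0 + N 1 0 - N 0 1 - N 1 1, N 0 1 + N 1 1, ?_, ?_, ?_⟩
  · linear_combination hN
  · rw [heig]
    push_cast
    linear_combination -e0
  · rw [heig]
    exact hk

theorem theorem1 (M : Matrix (Fin 2) (Fin 2) ℤ) (hdet : |M.det| = 1) (lam : ℂ)
    (heig : Module.End.HasEigenvalue (Matrix.toLin' (M.map (Int.cast : ℤ → ℂ))) lam)
    (hlam : 1 < ‖lam‖) :
    Nonempty (Heisenberg.SubNilmanifold ≃ₜ UnitAddCircle × UnitAddCircle) ∧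
    ∃ (l α β : ℝ) (hαβ : α + β = 1), (l : ℂ) = lam ∧ l ≠ (M.det : ℝ) ∧
      (∀ v : Fin 2 → ℂ,
        ((M.map (Int.cast : ℤ → ℂ)).mulVec v = lam • v ∧ v 0 + v 1 = 1) ↔
          v = ![(α : ℂ), (β : ℂ)]) ∧
      ∀ (n m : ℤ) (γ : ℝ),
        γ = α / (l - (M.det : ℝ)) * ((n : ℝ) - (M 0 0 : ℝ) * (M 1 0 : ℝ) / 2)
          + β / (l - (M.det : ℝ)) * ((m : ℝ) - (M 0 1 : ℝ) * (M 1 1 : ℝ) / 2) →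
        IsMinimalMap (Heisenberg.niltranslation α β γ hαβ) ∧
        IsUniquelyErgodic (Heisenberg.niltranslation α β γ hαβ) ∧
        ∀ μ : MeasureTheory.Measure Heisenberg.SubNilmanifold,
          MeasureTheory.IsProbabilityMeasure μ →
          MeasureTheory.MeasurePreserving (Heisenberg.niltranslation α β γ hαβ) μ μ →
          IsSelfInduced (Heisenberg.niltranslation α β γ hαβ) μ := by
  refine ⟨⟨Heisenberg.subNilmanifoldHomeomorph⟩, ?_⟩
  obtain ⟨l, rfl, hchar, hl⟩ := exists_real_eq_of_one_lt_norm hdet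
    (charpoly_eq_zero_of_hasEigenvalue M heig) hlam
  have hirr : Irrational l := irrational_of_quadratic hdet hchar hl
  rw [Matrix.trace_fin_two, Matrix.det_fin_two] at hchar
  push_cast at hchar
  -- The first eigenvector equation, with `β = 1 - α`, is linear in `α` and determines it.
  have hne : l - M 0 0 + M 0 1 ≠ 0 := fun h =>
    hirr.ne_int (M 0 0 - M 0 1) (by push_cast; linarith)
  obtain ⟨α, hα⟩ : ∃ α : ℝ, (l - M 0 0 + M 0 1) * α = M 0 1 := ⟨_, mul_div_cancel₀ _ hne⟩
  have h0 : M 0 0 * α + M 0 1 * (1 - α) = l * α := by linear_combination -hα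
  have h1 : M 1 0 * α + M 1 1 * (1 - α) = l * (1 - α) := by
    refine mul_left_cancel₀ hne ?_
    linear_combination ((M 1 0 : ℝ) - M 1 1 + l) * hα - hchar
  have hαβ : α + (1 - α) = 1 := by ring
  have hαirr : Irrational α := by
    rintro ⟨q, rfl⟩
    rcases eq_or_ne q 0 with rfl | hq
    · refine hirr.ne_int (M 1 1) ?_
      simpa using h1.symm
    · refine hirr ⟨(M 0 0 : ℚ) - M 0 1 + M 0 1 / q, ?_⟩
      have hq' : (q : ℝ) ≠ 0 := by exact_mod_cast hq
      push_cast
      field_simp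
      linear_combination -hα
  refine ⟨l, α, 1 - α, hαβ, rfl, hirr.ne_int _, ?_, ?_⟩
  · intro v
    have hneC : (l : ℂ) - M 0 0 + M 0 1 ≠ 0 := by exact_mod_cast hne
    have hαC : ((l : ℂ) - M 0 0 + M 0 1) * α = M 0 1 := by exact_mod_cast hα
    constructor
    · rintro ⟨hv, hsum⟩
      have e0 := congrFun hv 0
      simp only [Matrix.mulVec, dotProduct, Fin.sum_univ_two, Matrix.map_apply, Pi.smul_apply,
        smul_eq_mul] at e0
      have hv0 : v 0 = α := by
        refine mul_left_cancel₀ hneC ?_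
        rw [hαC]
        linear_combination (M 0 1 : ℂ) * hsum - e0
      have hv1 : v 1 = 1 - α := by rw [← hv0, ← hsum]; ring
      ext i
      fin_cases i
      · simpa using hv0
      · simpa using hv1
    · rintro rfl
      have h0C : (M 0 0 * α + M 0 1 * (1 - α) : ℂ) = l * α := by exact_mod_cast h0
      have h1C : (M 1 0 * α + M 1 1 * (1 - α) : ℂ) = l * (1 - α) := by exact_mod_cast h1
      refine ⟨?_, by simp⟩
      ext i
      fin_cases i
      · simpa [Matrix.mulVec, dotProduct, Fin.sum_univ_two] using h0C
      · simpa [Matrix.mulVec, dotProduct, Fin.sum_univ_two] using h1C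
  · intro n m γ _
    obtain ⟨a, b, c, s, hfix⟩ := exists_isExpandingFixedPoint M hdet hl hαβ h0 h1
    set κ : UnitAddCircle := ((γ - α : ℝ) : UnitAddCircle)
    let S : Torus ≃ᵐ Torus := (skewProduct α κ).toMeasurableEquiv
    let e : Heisenberg.SubNilmanifold ≃ᵐ Torus :=
      Heisenberg.subNilmanifoldHomeomorph.toMeasurableEquiv
    have hT : Heisenberg.niltranslation α (1 - α) γ hαβ = (e.trans S).trans e.symm := by
      funext p
      exact (Homeomorph.eq_symm_apply _).2
        (Heisenberg.subNilmanifoldHomeomorph_niltranslation α (1 - α) γ hαβ p)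
    have hue : IsUniquelyErgodic ((e.trans S).trans e.symm) :=
      (show IsUniquelyErgodic S from isUniquelyErgodic_skewProduct hαirr κ).conj e
    rw [hT]
    refine ⟨(isMinimalMap_skewProduct hαirr κ).conj Heisenberg.subNilmanifoldHomeomorph, hue, ?_⟩
    intro μ hμ hpres
    obtain ⟨Ψ, k, hΨ⟩ := exists_isSelfEmbedding_skewProduct hfix κ
    have : StandardBorelSpace Heisenberg.SubNilmanifold :=
      @standardBorel_of_polish _ _ _ _
        Heisenberg.subNilmanifoldHomeomorph.isClosedEmbedding.polishSpace
    exact (hΨ.conj e).isSelfInduced hue hpres
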